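/- Let $F$ be a finite field with $q=p^r$ elements ($p$ prime), and index the coordinates of $\mathbb{C}^q$ by the elements of $F$, with standard basis $\{e_w\}_{w\in F}$. The classical complete set of mutually unbiased bases coming from $F$ is $\mathcal{B}=\{B_\infty\}\cup\{B_m \mid m\in F\}$, where $B_\infty=\{e_w\mid w\in F\}$ and $B_m=\{b_{m,v}\mid v\in F\}$ with the following vectors. * If $p$ is odd, $b_{m,v}=\frac{1}{\sqrt q}\sum_{w\in F}\omega^{\mathrm{tr}(\frac12 mw^2+vw)}e_w$, where $\omega$ is a primitive $p$-th root of unity and $\mathrm{tr}$ is the trace from $F$ to its prime field. * If $p=2$, $b_{m,v}=\frac{1}{\sqrt q}\sum_{w\in F}\omega^{\mathrm{Tr}(\hat m\hat w^2+2\hat w\hat v)}e_w$, where $\omega$ is a primitive $4$-th root of unity, $\hat x$ is the Teichmüller lift of $x\in F$ to the Galois ring $GR(4^r)=W_2(F)$, and $\mathrm{Tr}:GR(4^r)\to\mathbb{Z}/4$ is the trace. Let $PGL_q(\mathbb{C})^+=PGL_q(\mathbb{C})\langle\tau\rangle$, acting on the set of $1$-dimensional subspaces of $\mathbb{C}^q$,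 where $\tau$ is coordinatewise complex conjugation. For a basis $B$ let $Ort(B)$ be the set of $1$-spaces spanned by the vectors of $B$, and let $$\mathrm{Aut}(\mathcal{B})=\{\psi\in PGL_q(\mathbb{C})^+\mid \text{for every } B_i\in\mathcal{B} \text{ there is } B_j\in\mathcal{B} \text{ with } \psi(Ort(B_i))=Ort(B_j)\}.$$ Write $G = N.Q$ if $G$ is an extension of $Q$ by $N$, that is, there is a short exact sequence $1\to N\to G\to Q\to 1$; it splits if $G\to Q$ has a section that is a homomorphism. Then $$\mathrm{Aut}(\mathcal{B})\cong \bigl(F^2.(SL_2(q).\mathbb{Z}_r)\bigr).\mathbb{Z}_2 ,$$ where $F^2$ is the additive group, and its image is normal in all of $\mathrm{Aut}(\mathcal{B})$. For suitable extensions of this form the following hold. If $p$ is odd, then all three extensions split, and $F^2$ also has a complement in $\mathrm{Aut}(\mathcal{B})$. If $p=2$ and $q\ge 8$, then the extension $F^2.(SL_2(q).\mathbb{Z}_r)$ is non-split. If $q=2$, then the factor $\mathbb{Z}_2$ is absent in the automorphism group $\mathrm{Aut}(\mathcal{D})$ of the corresponding orthogonal decomposition $\mathcal{D}=\{H_\infty\}\cup\{H_m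 \mid m \in F\}$ of the Lie algebra $sl_2(\mathbb{C})$, that is, $\mathrm{Aut}(\mathcal{D})\cong F^2.(SL_2(q).\mathbb{Z}_r)$. Here $H_i$ is the Cartan subalgebra of all traceless matrices that are diagonal with respect to $B_i$, and $\mathrm{Aut}(\mathcal{D})$ is the group of all automorphisms of the Lie algebra that map each $H_i$ onto some $H_j$. -/

import Mathlib

open scoped LinearAlgebra.Projectivization

universe u

/-! ### Automorphism groups of a family of bases of `ℂⁿ`

The index set of the coordinates of `ℂⁿ` is an arbitrary type `n`. -/

/-- A bijection that maps every member of a finite family of sets onto some member of the family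
has an inverse with the same property. -/
theorem permutes_symm {α ι : Type*} [Finite ι] (A : ι → Set α) (g : Equiv.Perm α)
    (hg : ∀ i, ∃ j, g '' A i = A j) (i : ι) : ∃ j, g.symm '' A i = A j := by
  have hmaps : Set.MapsTo (fun s : Set α => g '' s) (Set.range A) (Set.range A) := by
    rintro _ ⟨k, rfl⟩
    obtain ⟨j, hj⟩ := hg k
    exact ⟨j, hj.symm⟩
  have hinj : Set.InjOn (fun s : Set α => g '' s) (Set.range A) :=
    fun s _ t _ h => g.injective.image_injective h
  have hsurj := (((Set.finite_range A).injOn_iff_bijOn_of_mapsTo hmaps).1 hinj).surjOn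
  obtain ⟨_, ⟨j, rfl⟩, hj⟩ := hsurj ⟨i, rfl⟩
  refine ⟨j, ?_⟩
  rw [← hj]
  exact g.symm_image_image (A j)

section ProjectiveGroup

variable (n : Type*)

/-- Coordinatewise complex conjugation on `ℂⁿ`, as a semilinear map. -/
noncomputable def conjLin : (n → ℂ) →ₛₗ[starRingEnd ℂ] (n → ℂ) where
  toFun x := fun i => starRingEnd ℂ (x i)
  map_add' x y := by ext i; simp
  map_smul' c x := by ext i; simp

theorem conjLin_injective : Function.Injective (conjLin n) := by
  intro x y h
  ext i
  exact (starRingEnd ℂ).injective (congrFun h i)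

/-- The conjugation map `τ` on the set of `1`-spaces of `ℂⁿ`. -/
noncomputable def conjPoint (P : ℙ ℂ (n → ℂ)) : ℙ ℂ (n → ℂ) :=
  P.map (conjLin n) (conjLin_injective n)

theorem conjPoint_involutive : Function.Involutive (conjPoint n) := by
  intro P
  induction P using Projectivization.ind with
  | h v hv =>
    simp only [conjPoint, Projectivization.map_mk]
    congr 1
    ext i
    simp [conjLin]

/-- The conjugation map `τ` as a permutation of the set of `1`-spaces of `ℂⁿ`. -/
noncomputable def conjPerm : Equiv.Perm (ℙ ℂ (n → ℂ)) :=
  (conjPoint_involutive n).toPerm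

/-- `PGLₙ(ℂ)`, as the group of permutations of the set of `1`-spaces of `ℂⁿ` that are induced by
invertible linear maps. -/
noncomputable def projGL : Subgroup (Equiv.Perm (ℙ ℂ (n → ℂ))) :=
  (MulAction.toPermHom (LinearMap.GeneralLinearGroup ℂ (n → ℂ)) (ℙ ℂ (n → ℂ))).range

/-- `PGLₙ(ℂ)⁺ = PGLₙ(ℂ)⟨τ⟩`, the group generated by `PGLₙ(ℂ)` and the conjugation map `τ`. -/
noncomputable def projGLPlus : Subgroup (Equiv.Perm (ℙ ℂ (n → ℂ))) :=
  projGL n ⊔ Subgroup.zpowers (conjPerm n)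

end ProjectiveGroup

/-- The set of `1`-spaces generated by the vectors of a basis. -/
def orthoframe {n κ : Type*} (b : κ → n → ℂ) : Set (ℙ ℂ (n → ℂ)) :=
  {P | ∃ v, P.submodule = Submodule.span ℂ {b v}}

/-- The automorphism group of a finite family `B` of bases of `ℂⁿ`: the elements of `PGLₙ(ℂ)⁺`
that map the orthoframe of each basis onto the orthoframe of a basis of the family. -/
noncomputable def mubAut {n ι κ : Type*} [Finite ι] (B : ι → κ → n → ℂ) : Subgroup (projGLPlus n) where
  carrier := {ψ | ∀ i, ∃ j, ψ.1 '' orthoframe (B i) = orthoframe (B j)}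
  one_mem' i := ⟨i, by simp⟩
  mul_mem' {a b} ha hb i := by
    obtain ⟨j, hj⟩ := hb i
    obtain ⟨k, hk⟩ := ha j
    refine ⟨k, ?_⟩
    rw [← hk, ← hj, ← Set.image_comp]
    rfl
  inv_mem' {a} ha i := permutes_symm (fun i => orthoframe (B i)) a.1 ha i

/-- The Cartan subalgebra of `slₙ(ℂ)` associated with a basis: the traceless matrices that are
diagonal with respect to this basis. -/
def cartanOf {n κ : Type*} [Fintype n] [DecidableEq n] (b : κ → n → ℂ) :
    Set (LieAlgebra.SpecialLinear.sl n ℂ) :=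
  {A | ∀ v, ∃ c : ℂ, A.1.mulVec (b v) = c • b v}

/-- The automorphism group of the decomposition of `slₙ(ℂ)` that corresponds to a family `B` of
bases: the Lie algebra automorphisms of `slₙ(ℂ)` that map each of the subalgebras associated with
the bases onto one of these subalgebras. -/
noncomputable def odAut {n ι κ : Type*} [Fintype n] [DecidableEq n] [Finite ι] (B : ι → κ → n → ℂ) :
    Subgroup (LieAlgebra.SpecialLinear.sl n ℂ ≃ₗ[ℂ] LieAlgebra.SpecialLinear.sl n ℂ) where
  carrier := {φ | (∀ x y, φ ⁅x, y⁆ = ⁅φ x, φ y⁆) ∧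
    ∀ i, ∃ j, φ '' cartanOf (B i) = cartanOf (B j)}
  one_mem' := ⟨fun _ _ => rfl, fun i => ⟨i, by simp⟩⟩
  mul_mem' {a b} ha hb := by
    refine ⟨fun x y => ?_, fun i => ?_⟩
    · simp only [LinearEquiv.mul_apply, hb.1, ha.1]
    · obtain ⟨j, hj⟩ := hb.2 i
      obtain ⟨k, hk⟩ := ha.2 j
      refine ⟨k, ?_⟩
      rw [← hk, ← hj, ← Set.image_comp]
      rfl
  inv_mem' {a} ha := by
    refine ⟨fun x y => ?_, fun i => ?_⟩
    · change a.symm ⁅x, y⁆ = ⁅a.symm x, a.symm y⁆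
      rw [LinearEquiv.symm_apply_eq, ha.1]
      simp
    · exact permutes_symm (fun i => cartanOf (B i)) a.toEquiv ha.2 i

/-! ### The classical mutually unbiased bases of a finite field -/

section Classical

variable {F : Type*} [Field F]

/-- The trace of the Galois ring `GR(4ʳ) = W₂(F)`, where `|F| = 2ʳ`, of the class modulo `4` of a
Witt vector `x` over `F`. It is the sum of the conjugates under the Frobenius automorphism, which
maps `a + 2b` to `a² + 2b²` for Teichmüller representatives `a`, `b`. -/
noncomputable def galoisTrace (r : ℕ) (x : WittVector 2 F) : TruncatedWittVector 2 2 F :=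
  WittVector.truncate 2 (∑ i ∈ Finset.range r, (WittVector.frobenius : WittVector 2 F →+* _)^[i] x)

/-- `ω ^ Tr(ŵ (ŵ m̂) + 2 ŵ v̂)`, where the hat is the Teichmüller lift. The trace lies in the prime
ring `ℤ/4` of the Galois ring, and an integer that represents it is used as the exponent. -/
noncomputable def evenPhase (r : ℕ) (ω : ℂ) (m v w : F) : ℂ :=
  let t : F → WittVector 2 F := WittVector.teichmuller 2
  ω ^ Function.invFun (Int.cast : ℤ → TruncatedWittVector 2 2 F)
    (galoisTrace r (t w * (t w * t m) + 2 * (t w * t v)))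

/-- `ω ^ tr(½ w (w m) + v w)`, where `tr` is the trace from `F` to its prime field. -/
noncomputable def oddPhase (p : ℕ) [Algebra (ZMod p) F] (ω : ℂ) (m v w : F) : ℂ :=
  ω ^ (Algebra.trace (ZMod p) F ((2 : F)⁻¹ * (w * (w * m)) + v * w)).val

/-- The classical complete set of mutually unbiased bases coming from the field `F` with `p ^ r`
elements. The bases are indexed by `F ∪ {∞}`. The basis with index `∞` is the standard basis, and
the basis with index `m ∈ F` consists of the vectors `b_{m,v}`, `v ∈ F`. Here `ω` is a primitive
`p`-th root of unity if `p` is odd, and a primitive fourth root of unity if `p = 2`. -/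
noncomputable def classicalMUB [Fintype F] [DecidableEq F] (p r : ℕ) [Algebra (ZMod p) F] (ω : ℂ) :
    Option F → F → F → ℂ
  | none, v => Pi.single v 1
  | some m, v => fun w => ((Real.sqrt (Fintype.card F) : ℝ) : ℂ)⁻¹ *
      if p = 2 then evenPhase r ω m v w else oddPhase p ω m v w

end Classical

/-! The field enters only through a primitive additive character χ, invariant under field
automorphisms, and nowhere vanishing functions g m with g m (w + w') = g m w * g m w' * χ (m w w').
In odd characteristic g m w = χ (m w² / 2); in characteristic two the halving is impossible, and
Teichmüller lifts modulo 4 supply functions g m whose values are fourth roots of unity. `IsFramed`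
records these data, and the structure of Aut(B) is derived from them for all q at once.

The Weyl operators v ↦ (w ↦ χ (b w) v (w - a)) form a copy of F² in PGL, and the 1-spaces of the
i-th basis are exactly those fixed by the operators on the i-th line of F²
(`IsFramed.mem_orthoframe_iff`). Hence a projective map that normalizes the Weyl group and permutes
the lines of F² permutes the bases. Multiplications by g t, substitutions w ↦ c θ(w) and the Fourier
transform realize all of SL₂(F) ⋊ Aut(F) (`IsFramed.exists_covers`); complex conjugation acts as (a,
b) ↦ (a, -b). Conversely, SL₂ moves any two lines to the standard ones, so a linear automorphism can
be corrected to fix the frames ∞ and 0 and a point of each. It is then a permutation matrix up to a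
scalar; the permutation is additive because it permutes characters, and semilinear because it
permutes the forms χ (m x y) (`IsFramed.exists_covers_of_permutes`). The Weyl group is its own
centralizer in PGL (`IsFramed.exists_eq_weylPerm`), so the linear automorphisms form F².(SL₂(F) ⋊
Aut(F)), and conjugation doubles this group.

For odd q the operator v ↦ (w ↦ v (-w)) inverts F², and its centralizer is a complement. In
characteristic two a section over the transvections would make t ↦ t^(-1/2) additive, which forces
t² + t + 1 = 0 for all t ≠ 0, 1 and so q ≤ 4 (`IsFramed.isEmpty_splitting`).

For q = 2, Pauli coordinates turn sl₂ into ℂ³ with a multiple of the cross product and the three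
Cartan subalgebras into the coordinate axes. The automorphisms that permute the axes are the signed
permutations of determinant one: the sign changes form F², and the permutations of the axes form S₃
≅ SL₂(2). -/

set_option linter.unusedSectionVars false

/-! ### Projective maps, complex conjugation and monomial operators -/

section Projective

variable {n : Type*}

/-- The permutation of the set of `1`-spaces of `ℂⁿ` induced by an invertible linear map. -/
noncomputable def projMap : ((n → ℂ) ≃ₗ[ℂ] (n → ℂ)) →* Equiv.Perm (ℙ ℂ (n → ℂ)) :=
  MulAction.toPermHom ((n → ℂ) ≃ₗ[ℂ] (n → ℂ)) (ℙ ℂ (n → ℂ))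

theorem projMap_mk (U : (n → ℂ) ≃ₗ[ℂ] (n → ℂ)) {v : n → ℂ} (hv : v ≠ 0) :
    projMap U (Projectivization.mk ℂ v hv) =
      Projectivization.mk ℂ (U v) (U.map_ne_zero_iff.2 hv) := rfl

theorem mem_projGL_iff {ψ : Equiv.Perm (ℙ ℂ (n → ℂ))} :
    ψ ∈ projGL n ↔ ∃ U, projMap U = ψ := by
  constructor
  · rintro ⟨g, rfl⟩
    refine ⟨LinearMap.GeneralLinearGroup.generalLinearEquiv ℂ _ g, ?_⟩
    ext P
    induction P using Projectivization.ind with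
    | h v hv => rfl
  · rintro ⟨U, rfl⟩
    refine ⟨(LinearMap.GeneralLinearGroup.generalLinearEquiv ℂ _).symm U, ?_⟩
    ext P
    induction P using Projectivization.ind with
    | h v hv => rfl

theorem projMap_mem_projGL (U : (n → ℂ) ≃ₗ[ℂ] (n → ℂ)) : projMap U ∈ projGL n :=
  mem_projGL_iff.2 ⟨U, rfl⟩

theorem projMap_eq_of_smul {A B : (n → ℂ) ≃ₗ[ℂ] (n → ℂ)} (c : ℂ)
    (h : ∀ v, A v = c • B v) : projMap A = projMap B := by
  ext P
  induction P using Projectivization.ind with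
  | h v hv =>
    rw [projMap_mk, projMap_mk, Projectivization.mk_eq_mk_iff']
    exact ⟨c, (h v).symm⟩

theorem conjPerm_mk {v : n → ℂ} (hv : v ≠ 0) :
    conjPerm n (Projectivization.mk ℂ v hv) = Projectivization.mk ℂ (conjLin n v)
      ((map_ne_zero_iff _ (conjLin_injective n)).2 hv) := rfl

theorem conjPerm_mul_self : conjPerm n * conjPerm n = 1 := by
  exact Equiv.ext (conjPoint_involutive n)

/-- The conjugate of an invertible linear map by coordinatewise complex conjugation. -/
noncomputable def conjEquiv (U : (n → ℂ) ≃ₗ[ℂ] (n → ℂ)) : (n → ℂ) ≃ₗ[ℂ] (n → ℂ) where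
  toFun v := conjLin n (U (conjLin n v))
  invFun v := conjLin n (U.symm (conjLin n v))
  map_add' v w := by simp
  map_smul' c v := by simp [LinearMap.map_smulₛₗ]
  left_inv v := by
    have h : ∀ x, conjLin n (conjLin n x) = x := fun x => by ext i; simp [conjLin]
    simp [h]
  right_inv v := by
    have h : ∀ x, conjLin n (conjLin n x) = x := fun x => by ext i; simp [conjLin]
    simp [h]

theorem conjPerm_mul_projMap (U : (n → ℂ) ≃ₗ[ℂ] (n → ℂ)) :
    conjPerm n * projMap U = projMap (conjEquiv U) * conjPerm n := by
  ext P
  induction P using Projectivization.ind with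
  | h v hv =>
    simp only [Equiv.Perm.mul_apply, projMap_mk, conjPerm_mk]
    congr 1
    change _ = conjLin n (U (conjLin n (conjLin n v)))
    congr 2
    ext i
    simp [conjLin]

theorem conjPerm_conj_mem_projGL {ψ : Equiv.Perm (ℙ ℂ (n → ℂ))} (hψ : ψ ∈ projGL n) :
    conjPerm n * ψ * conjPerm n ∈ projGL n := by
  obtain ⟨U, rfl⟩ := mem_projGL_iff.1 hψ
  rw [conjPerm_mul_projMap, mul_assoc, conjPerm_mul_self, mul_one]
  exact projMap_mem_projGL _

theorem mul_conjPerm_conjPerm (ψ : Equiv.Perm (ℙ ℂ (n → ℂ))) :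
    ψ * conjPerm n * conjPerm n = ψ := by
  rw [mul_assoc, conjPerm_mul_self, mul_one]

theorem conjPerm_inv : (conjPerm n)⁻¹ = conjPerm n :=
  inv_eq_of_mul_eq_one_left conjPerm_mul_self

/-- Conjugation by τ preserves PGL and τ² = 1, so the union of PGL and its coset by τ is already
closed under products and inverses. -/
theorem mem_projGLPlus_iff {ψ : Equiv.Perm (ℙ ℂ (n → ℂ))} :
    ψ ∈ projGLPlus n ↔ ψ ∈ projGL n ∨ ψ * conjPerm n ∈ projGL n := by
  constructor
  · let S : Subgroup (Equiv.Perm (ℙ ℂ (n → ℂ))) :=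
      { carrier := {ψ | ψ ∈ projGL n ∨ ψ * conjPerm n ∈ projGL n}
        one_mem' := Or.inl (one_mem _)
        mul_mem' := by
          rintro a b (ha | ha) (hb | hb)
          · exact Or.inl (mul_mem ha hb)
          · exact Or.inr (by rw [mul_assoc]; exact mul_mem ha hb)
          · refine Or.inr ?_
            have := mul_mem ha (conjPerm_conj_mem_projGL hb)
            rwa [mul_assoc (conjPerm n), ← mul_assoc, mul_conjPerm_conjPerm, ← mul_assoc] at this
          · refine Or.inl ?_
            have := mul_mem ha (conjPerm_conj_mem_projGL hb)
            rwa [mul_assoc (conjPerm n), ← mul_assoc, mul_conjPerm_conjPerm,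
              mul_conjPerm_conjPerm] at this
        inv_mem' := by
          rintro a (ha | ha)
          · exact Or.inl (inv_mem ha)
          · refine Or.inr ?_
            have := conjPerm_conj_mem_projGL (inv_mem ha)
            rwa [mul_inv_rev, conjPerm_inv, ← mul_assoc, conjPerm_mul_self, one_mul] at this }
    have h : projGLPlus n ≤ S := by
      refine sup_le (fun a ha => Or.inl ha) ?_
      rw [Subgroup.zpowers_le]
      exact Or.inr (by rw [conjPerm_mul_self]; exact one_mem _)
    exact fun hψ => h hψ
  · have h2 : conjPerm n ∈ projGLPlus n :=
      (le_sup_right : Subgroup.zpowers _ ≤ projGLPlus n) (Subgroup.mem_zpowers _)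
    rintro (h | h)
    · exact (le_sup_left : projGL n ≤ projGLPlus n) h
    · have h1 : ψ * conjPerm n ∈ projGLPlus n := (le_sup_left : projGL n ≤ projGLPlus n) h
      rw [← mul_conjPerm_conjPerm ψ]
      exact mul_mem h1 h2

theorem mem_orthoframe_mk {κ : Type*} {b : κ → n → ℂ} {v : n → ℂ} (hv : v ≠ 0) :
    Projectivization.mk ℂ v hv ∈ orthoframe b ↔ ∃ k, ∃ c : ℂ, c ≠ 0 ∧ v = c • b k := by
  simp only [orthoframe, Set.mem_ofPred_eq, Projectivization.submodule_mk]
  refine exists_congr fun k => ?_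
  rw [Submodule.span_singleton_eq_span_singleton]
  constructor
  · rintro ⟨z, hz⟩
    exact ⟨(z⁻¹ : ℂˣ), by simp, by rw [← hz, ← Units.smul_def, inv_smul_smul]⟩
  · rintro ⟨c, hc, h⟩
    exact ⟨(Units.mk0 c hc)⁻¹, by rw [h, inv_smul_eq_iff]; rfl⟩

/-- The monomial transformation `v ↦ (w ↦ d w * v (π w))`. -/
noncomputable def monomialEquiv (π : Equiv.Perm n) (d : n → ℂ) (hd : ∀ w, d w ≠ 0) :
    (n → ℂ) ≃ₗ[ℂ] (n → ℂ) where
  toFun v w := d w * v (π w)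
  invFun v w := (d (π.symm w))⁻¹ * v (π.symm w)
  map_add' v w := by ext; simp [mul_add]
  map_smul' c v := by ext; simp [mul_left_comm]
  left_inv v := by ext w; simp [hd]
  right_inv v := by ext w; simp [hd]

@[simp] theorem monomialEquiv_apply (π : Equiv.Perm n) (d : n → ℂ) (hd : ∀ w, d w ≠ 0)
    (v : n → ℂ) (w : n) : monomialEquiv π d hd v w = d w * v (π w) := rfl

end Projective

theorem AddChar.apply_ne_zero {F : Type*} [AddGroup F] (χ : AddChar F ℂ) (x : F) : χ x ≠ 0 :=
  (χ.val_isUnit x).ne_zero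

/-! ### Weyl operators and the bases as their common eigenvectors -/

section Framed

variable {F : Type*} [Field F] [Fintype F] [DecidableEq F]

/-- A family of bases of `ℂ^F` given by a primitive additive character `χ` that is invariant under
field automorphisms and functions `g m` that are quadratic with polarization `χ (m * w * w')`. -/
structure IsFramed (χ : AddChar F ℂ) (g : F → F → ℂ) (B : Option F → F → F → ℂ) : Prop where
  primitive : χ.IsPrimitive
  map_ringAut : ∀ (θ : RingAut F) (x : F), χ (θ x) = χ x
  ne_zero : ∀ m w, g m w ≠ 0
  add : ∀ m w w', g m (w + w') = g m w * g m w' * χ (m * w * w')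
  basis_none : ∀ v, B none v = Pi.single v 1
  basis_some : ∃ c : ℂ, c ≠ 0 ∧ ∀ m v w, B (some m) v w = c * (g m w * χ (v * w))

variable {χ : AddChar F ℂ} {g : F → F → ℂ} {B : Option F → F → F → ℂ}

theorem AddChar.IsPrimitive.eq_of_forall (hχ : χ.IsPrimitive) {x y : F}
    (h : ∀ b, χ (b * x) = χ (b * y)) : x = y := by
  refine AddChar.to_mulShift_inj_of_isPrimitive hχ ?_
  ext b
  simpa [AddChar.mulShift_apply, mul_comm] using h b

/-- The characters χ (k ·) are pairwise distinct, and F has exactly |F| characters. -/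
theorem AddChar.IsPrimitive.exists_eq (hχ : χ.IsPrimitive) (ψ : AddChar F ℂ) :
    ∃ k, ∀ x, ψ x = χ (k * x) := by
  have hinj := AddChar.to_mulShift_inj_of_isPrimitive hχ
  have hbij := (Fintype.bijective_iff_injective_and_card (fun k => χ.mulShift k)).2
    ⟨hinj, (AddChar.card_eq (α := F)).symm⟩
  obtain ⟨k, rfl⟩ := hbij.2 ψ
  exact ⟨k, fun x => AddChar.mulShift_apply⟩

theorem IsFramed.zero_right (h : IsFramed χ g B) (m : F) : g m 0 = 1 := by
  have := h.add m 0 0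
  have h0 := h.ne_zero m 0
  simp only [add_zero, mul_zero, AddChar.map_zero_eq_one, mul_one] at this
  exact (mul_eq_left₀ h0).1 this.symm

/-- The Weyl operator `v ↦ (w ↦ χ (b * w) * v (w - a))` for `x = (a, b)`. -/
noncomputable def weyl (χ : AddChar F ℂ) (x : F × F) : (F → ℂ) ≃ₗ[ℂ] (F → ℂ) :=
  monomialEquiv (Equiv.subRight x.1) (fun w => χ (x.2 * w)) fun _ => χ.apply_ne_zero _

@[simp] theorem weyl_apply (χ : AddChar F ℂ) (x : F × F) (v : F → ℂ) (w : F) :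
    weyl χ x v w = χ (x.2 * w) * v (w - x.1) := rfl

/-- The permutation of the set of `1`-spaces induced by a Weyl operator. -/
noncomputable def weylPerm (χ : AddChar F ℂ) (x : F × F) : Equiv.Perm (ℙ ℂ (F → ℂ)) :=
  projMap (weyl χ x)

/-- Weyl operators multiply only up to a root of unity, which is invisible on 1-spaces; this is why
F² itself, and not a Heisenberg group, appears. -/
theorem weylPerm_add (χ : AddChar F ℂ) (x y : F × F) :
    weylPerm χ (x + y) = weylPerm χ x * weylPerm χ y := by
  rw [weylPerm, weylPerm, weylPerm, ← map_mul]
  refine projMap_eq_of_smul (χ (y.2 * x.1)) fun v => ?_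
  ext w
  simp only [weyl_apply, LinearEquiv.mul_apply, Pi.smul_apply, smul_eq_mul, Prod.fst_add,
    Prod.snd_add, ← sub_sub, ← mul_assoc, ← AddChar.map_add_eq_mul]
  congr 2
  ring

theorem weylPerm_zero (χ : AddChar F ℂ) : weylPerm χ 0 = 1 := by
  have := weylPerm_add χ 0 0
  rw [add_zero] at this
  exact left_eq_mul.1 this

theorem weylPerm_neg (χ : AddChar F ℂ) (x : F × F) : weylPerm χ (-x) = (weylPerm χ x)⁻¹ := by
  rw [eq_inv_iff_mul_eq_one, ← weylPerm_add, neg_add_cancel, weylPerm_zero]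

/-- `ψ` normalizes the group of Weyl operators and acts on it as `f`. -/
def Covers (χ : AddChar F ℂ) (ψ : Equiv.Perm (ℙ ℂ (F → ℂ))) (f : F × F → F × F) : Prop :=
  ∀ x, ψ * weylPerm χ x = weylPerm χ (f x) * ψ

theorem Covers.mul {ψ ψ' : Equiv.Perm (ℙ ℂ (F → ℂ))} {f f' : F × F → F × F}
    (h : Covers χ ψ f) (h' : Covers χ ψ' f') : Covers χ (ψ * ψ') (f ∘ f') := by
  intro x
  rw [mul_assoc, h', ← mul_assoc, h, mul_assoc]
  rfl

theorem Covers.inv {ψ : Equiv.Perm (ℙ ℂ (F → ℂ))} {f f' : F × F → F × F}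
    (h : Covers χ ψ f) (hf : ∀ x, f (f' x) = x) : Covers χ ψ⁻¹ f' := by
  intro x
  rw [inv_mul_eq_iff_eq_mul, ← mul_assoc, h, mul_inv_cancel_right, hf]

theorem covers_weylPerm (χ : AddChar F ℂ) (y : F × F) : Covers χ (weylPerm χ y) id := by
  intro x
  rw [← weylPerm_add, add_comm, weylPerm_add]
  rfl

theorem covers_projMap {U : (F → ℂ) ≃ₗ[ℂ] (F → ℂ)} {f : F × F → F × F} (c : F × F → ℂ)
    (h : ∀ x v w, U (weyl χ x v) w = c x * weyl χ (f x) (U v) w) : Covers χ (projMap U) f := by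
  intro x
  rw [weylPerm, weylPerm, ← map_mul, ← map_mul]
  refine projMap_eq_of_smul (c x) fun v => ?_
  ext w
  exact h x v w

/-- The `1`-spaces of `F²`, indexed by `F ∪ {∞}`. -/
def lineSet : Option F → Set (F × F)
  | none => {x | x.1 = 0}
  | some m => {x | x.2 = m * x.1}

theorem IsFramed.mem_orthoframe_none (h : IsFramed χ g B) {v : F → ℂ} (hv : v ≠ 0) :
    Projectivization.mk ℂ v hv ∈ orthoframe (B none) ↔ ∃ k, ∃ c : ℂ, c ≠ 0 ∧
      v = c • (Pi.single k 1 : F → ℂ) := by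
  rw [mem_orthoframe_mk]
  simp only [h.basis_none]

theorem IsFramed.mem_orthoframe_some (h : IsFramed χ g B) (m : F) {v : F → ℂ} (hv : v ≠ 0) :
    Projectivization.mk ℂ v hv ∈ orthoframe (B (some m)) ↔ ∃ k, ∃ c : ℂ, c ≠ 0 ∧
      ∀ w, v w = c * (g m w * χ (k * w)) := by
  rw [mem_orthoframe_mk]
  obtain ⟨c₀, hc₀, hB⟩ := h.basis_some
  refine exists_congr fun k => ⟨?_, ?_⟩
  · rintro ⟨c, hc, rfl⟩
    exact ⟨c * c₀, mul_ne_zero hc hc₀, fun w => by simp [hB, mul_assoc]⟩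
  · rintro ⟨c, hc, hw⟩
    refine ⟨c * c₀⁻¹, mul_ne_zero hc (inv_ne_zero hc₀), ?_⟩
    ext w
    simp [hB, hw, mul_assoc, hc₀]

theorem weylPerm_mk_eq_iff (χ : AddChar F ℂ) (x : F × F) {v : F → ℂ} (hv : v ≠ 0) :
    weylPerm χ x (Projectivization.mk ℂ v hv) = Projectivization.mk ℂ v hv ↔
      ∃ c : ℂ, ∀ w, χ (x.2 * w) * v (w - x.1) = c * v w := by
  rw [weylPerm, projMap_mk, Projectivization.mk_eq_mk_iff']
  refine exists_congr fun c => ?_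
  rw [funext_iff]
  exact forall_congr' fun w => eq_comm

/-- For ∞ the operators of the line are diagonal and separate the coordinates. For m, division by g
m turns them into translations up to scalars, and a common eigenvector of all translations is a
multiple of a character. -/
theorem IsFramed.mem_orthoframe_iff (h : IsFramed χ g B) (i : Option F) (P : ℙ ℂ (F → ℂ)) :
    P ∈ orthoframe (B i) ↔ ∀ x ∈ lineSet i, weylPerm χ x P = P := by
  induction P using Projectivization.ind with
  | h v hv =>
  simp only [weylPerm_mk_eq_iff]
  cases i with
  | none =>
    rw [h.mem_orthoframe_none]
    constructor
    · rintro ⟨k, c, hc, rfl⟩ ⟨a, b⟩ hx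
      obtain rfl : a = 0 := hx
      refine ⟨χ (b * k), fun w => ?_⟩
      by_cases hw : w = k
      · simp [hw]
      · simp [hw]
    · intro H
      obtain ⟨k, hk⟩ := Function.ne_iff.1 hv
      refine ⟨k, v k, hk, ?_⟩
      ext w
      by_cases hw : w = k
      · simp [hw]
      · simp only [Pi.smul_apply, Pi.single_eq_of_ne hw, smul_zero]
        -- If v is nonzero at both w and k, the eigenvalue of the operator (0, b) equals χ (b w) and
        -- χ (b k) for every b.
        by_contra hvw
        refine hw (h.primitive.eq_of_forall fun b => ?_)
        obtain ⟨c, hc⟩ := H (0, b) rfl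
        have h1 := hc w
        have h2 := hc k
        simp only [sub_zero] at h1 h2
        rw [mul_right_cancel₀ hvw h1, mul_right_cancel₀ hk h2]
  | some m =>
    rw [h.mem_orthoframe_some]
    constructor
    · rintro ⟨k, c, hc, hv'⟩ ⟨a, b⟩ hx
      obtain rfl : b = m * a := hx
      refine ⟨χ (m * a * a) * χ (-(k * a)) / g m a, fun w => ?_⟩
      have hga := h.ne_zero m a
      have h1 := h.add m (w - a) a
      rw [sub_add_cancel] at h1
      rw [hv', hv', h1, div_mul_eq_mul_div, eq_div_iff hga]
      have h2 : χ (m * a * w) = χ (m * a * a) * χ (m * (w - a) * a) := by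
        rw [← AddChar.map_add_eq_mul]; congr 1; ring
      have h3 : χ (k * (w - a)) = χ (-(k * a)) * χ (k * w) := by
        rw [← AddChar.map_add_eq_mul]; congr 1; ring
      rw [h2, h3]
      ring
    · intro H
      have hu : ∀ a, ∃ μ, ∀ w, v (w + a) / g m (w + a) = μ * (v w / g m w) := by
        intro a
        obtain ⟨c, hc⟩ := H (-a, m * -a) rfl
        simp only [sub_neg_eq_add] at hc
        refine ⟨c / g m a, fun w => ?_⟩
        have h1 := h.ne_zero m a
        have h2 := h.ne_zero m w
        have h3 := χ.apply_ne_zero (m * w * a)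
        have h4 := hc w
        have h5 : χ (m * -a * w) = (χ (m * w * a))⁻¹ := by
          rw [← AddChar.map_neg_eq_inv]; congr 1; ring
        rw [h5, inv_mul_eq_iff_eq_mul₀ h3] at h4
        rw [h.add, h4]
        field_simp
      set u : F → ℂ := fun w => v w / g m w with hu_def
      obtain ⟨k, hk⟩ := Function.ne_iff.1 hv
      have hu0 : u 0 ≠ 0 := by
        intro h0
        obtain ⟨μ, hμ⟩ := hu k
        have := hμ 0
        rw [show v 0 / g m 0 = 0 from h0, mul_zero, zero_add] at this
        exact div_ne_zero hk (h.ne_zero m k) this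
      -- The eigenvalue of each translation is read off at 0, so u / u 0 is an additive character.
      have hmul : ∀ w a, u (w + a) = u a / u 0 * u w := by
        intro w a
        obtain ⟨μ, hμ⟩ := hu a
        have h1 : u a = μ * u 0 := by have := hμ 0; rwa [zero_add] at this
        rw [h1, mul_div_cancel_right₀ _ hu0]
        exact hμ w
      obtain ⟨j, hj⟩ := h.primitive.exists_eq
        { toFun := fun a => u a / u 0
          map_zero_eq_one' := div_self hu0
          map_add_eq_mul' := fun a b => by rw [hmul]; ring }
      refine ⟨j, u 0, hu0, fun w => ?_⟩
      rw [← hj w]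
      change v w = u 0 * (g m w * (v w / g m w / u 0))
      have := h.ne_zero m w
      field_simp

/-- Conjugation carries fixed points to fixed points, and the frames are fixed-point sets of the
subgroups of the Weyl group given by the lines. -/
theorem IsFramed.mem_orthoframe_of_covers (h : IsFramed χ g B) {ψ : Equiv.Perm (ℙ ℂ (F → ℂ))}
    {f : F × F → F × F} (hψ : Covers χ ψ f) {i j : Option F} (hf : f '' lineSet i = lineSet j)
    (P : ℙ ℂ (F → ℂ)) : ψ P ∈ orthoframe (B j) ↔ P ∈ orthoframe (B i) := by
  rw [h.mem_orthoframe_iff, h.mem_orthoframe_iff, ← hf, Set.forall_mem_image]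
  refine forall₂_congr fun x _ => ?_
  have := congrArg (fun σ => σ P) (hψ x)
  simp only [Equiv.Perm.mul_apply] at this
  rw [← this, ψ.injective.eq_iff]

theorem IsFramed.image_orthoframe (h : IsFramed χ g B) {ψ : Equiv.Perm (ℙ ℂ (F → ℂ))}
    {f : F × F → F × F} (hψ : Covers χ ψ f) {i j : Option F} (hf : f '' lineSet i = lineSet j) :
    ψ '' orthoframe (B i) = orthoframe (B j) := by
  ext P
  rw [Equiv.image_eq_preimage_symm, Set.mem_preimage, ← h.mem_orthoframe_of_covers hψ hf,
    Equiv.apply_symm_apply]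

/-- The operator `v ↦ (w ↦ v (c * θ w))`. -/
noncomputable def substEquiv (c : Fˣ) (θ : RingAut F) : (F → ℂ) ≃ₗ[ℂ] (F → ℂ) :=
  monomialEquiv (θ.toEquiv.trans (Units.mulLeft c)) (fun _ => 1) fun _ => one_ne_zero

@[simp] theorem substEquiv_apply (c : Fˣ) (θ : RingAut F) (v : F → ℂ) (w : F) :
    substEquiv c θ v w = v (c * θ w) := by
  simp [substEquiv]

theorem IsFramed.covers_substEquiv (h : IsFramed χ g B) (c : Fˣ) (θ : RingAut F) :
    Covers χ (projMap (substEquiv c θ))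
      fun x => (θ.symm ((c⁻¹ : Fˣ) * x.1), θ.symm (c * x.2)) := by
  refine covers_projMap (fun _ => 1) fun x v w => ?_
  simp only [substEquiv_apply, weyl_apply, one_mul]
  congr 1
  · rw [← h.map_ringAut θ.symm]
    simp [mul_left_comm, mul_assoc]
  · congr 1
    simp [mul_sub]

/-- The multiplication operator with the quadratic function `g t`. -/
noncomputable def IsFramed.diagEquiv (h : IsFramed χ g B) (t : F) : (F → ℂ) ≃ₗ[ℂ] (F → ℂ) :=
  monomialEquiv (Equiv.refl F) (g t) (h.ne_zero t)

@[simp] theorem IsFramed.diagEquiv_apply (h : IsFramed χ g B) (t : F) (v : F → ℂ) (w : F) :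
    h.diagEquiv t v w = g t w * v w := rfl

/-- Conjugating the translation by a with the quadratic function g t produces its polarization χ (t
a ·), up to a scalar. -/
theorem IsFramed.covers_diagEquiv (h : IsFramed χ g B) (t : F) :
    Covers χ (projMap (h.diagEquiv t)) fun x => (x.1, x.2 + t * x.1) := by
  refine covers_projMap (fun x => g t x.1 * χ (-(t * x.1 * x.1))) fun x v w => ?_
  simp only [diagEquiv_apply, weyl_apply]
  have h1 := h.add t (w - x.1) x.1
  rw [sub_add_cancel] at h1
  have h2 : χ ((x.2 + t * x.1) * w) = χ (x.2 * w) * χ (t * x.1 * w) := by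
    rw [← AddChar.map_add_eq_mul]; congr 1; ring
  have h3 : χ (t * (w - x.1) * x.1) = χ (-(t * x.1 * x.1)) * χ (t * x.1 * w) := by
    rw [← AddChar.map_add_eq_mul]; congr 1; ring
  rw [h1, h2, h3]
  ring

/-- The Fourier transform on `ℂ^F`. -/
noncomputable def fourierEquiv (hχ : χ.IsPrimitive) : (F → ℂ) ≃ₗ[ℂ] (F → ℂ) :=
  LinearEquiv.ofInjectiveEndo
    { toFun := fun v w => ∑ u, χ (w * u) * v u
      map_add' := fun v v' => by ext w; simp [mul_add, Finset.sum_add_distrib]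
      map_smul' := fun c v => by ext w; simp [Finset.mul_sum, mul_left_comm] } <| by
    rw [← LinearMap.ker_eq_bot, LinearMap.ker_eq_bot']
    intro v hv
    ext u₀
    -- Fourier inversion: pairing the vanishing transform with w ↦ χ (-w u₀) leaves |F| * v u₀ by
    -- orthogonality of characters.
    have h1 : ∑ w, χ (w * -u₀) * ∑ u, χ (w * u) * v u = 0 := by
      refine Finset.sum_eq_zero fun w _ => ?_
      have : ∑ u, χ (w * u) * v u = 0 := congrFun hv w
      rw [this, mul_zero]
    simp only [Finset.mul_sum] at h1
    rw [Finset.sum_comm] at h1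
    have h2 : ∀ u, ∑ w, χ (w * -u₀) * (χ (w * u) * v u) =
        if u = u₀ then (Fintype.card F : ℂ) * v u else 0 := by
      intro u
      simp only [← mul_assoc, ← AddChar.map_add_eq_mul, ← Finset.sum_mul, ← mul_add]
      rw [AddChar.sum_mulShift _ hχ]
      simp [neg_add_eq_sub, sub_eq_zero, ite_mul]
    simp only [h2] at h1
    simpa using h1

@[simp] theorem fourierEquiv_apply (hχ : χ.IsPrimitive) (v : F → ℂ) (w : F) :
    fourierEquiv hχ v w = ∑ u, χ (w * u) * v u := rfl

theorem covers_fourierEquiv (hχ : χ.IsPrimitive) :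
    Covers χ (projMap (fourierEquiv hχ)) fun x => (-x.2, x.1) := by
  refine covers_projMap (fun x => χ (x.2 * x.1)) fun x v w => ?_
  simp only [fourierEquiv_apply, weyl_apply, Finset.mul_sum]
  refine Fintype.sum_equiv (Equiv.subRight x.1) _ _ fun u => ?_
  simp only [Equiv.subRight_apply, ← mul_assoc, ← AddChar.map_add_eq_mul]
  congr 2
  ring

theorem covers_conjPerm (χ : AddChar F ℂ) : Covers χ (conjPerm F) fun x => (x.1, -x.2) := by
  intro x
  rw [weylPerm, conjPerm_mul_projMap, weylPerm]
  congr 1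
  refine projMap_eq_of_smul 1 fun v => ?_
  ext w
  change starRingEnd ℂ (χ (x.2 * w) * starRingEnd ℂ (v (w - x.1))) = _
  have hpos : 0 < ringChar F := Nat.pos_of_ne_zero (CharP.ringChar_ne_zero_of_finite F)
  rw [map_mul, Complex.conj_conj, AddChar.starComp_apply hpos]
  simp

end Framed

/-! ### The group SL₂(F) ⋊ Aut(F) and the lines of F² -/

section SemilinearGroup

variable {F : Type*} [Field F]

/-- The isomorphism of special linear groups induced by an isomorphism of fields. -/
def slCongr {F F' : Type*} [Field F] [Field F'] (θ : F ≃+* F') :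
    Matrix.SpecialLinearGroup (Fin 2) F ≃* Matrix.SpecialLinearGroup (Fin 2) F' where
  toFun := Matrix.SpecialLinearGroup.map (θ : F →+* F')
  invFun := Matrix.SpecialLinearGroup.map (θ.symm : F' →+* F)
  left_inv A := by ext i j; simp
  right_inv A := by ext i j; simp
  map_mul' := map_mul _

@[simp] theorem slCongr_apply {F F' : Type*} [Field F] [Field F'] (θ : F ≃+* F')
    (A : Matrix.SpecialLinearGroup (Fin 2) F) (i j : Fin 2) : slCongr θ A i j = θ (A i j) := rfl

/-- The action of the field automorphisms on `SL₂` by application to the entries. -/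
def ringAutSL (F : Type*) [Field F] :
    RingAut F →* MulAut (Matrix.SpecialLinearGroup (Fin 2) F) where
  toFun θ := slCongr θ
  map_one' := by ext A i j; simp
  map_mul' θ θ' := by ext A i j; simp

/-- The group `SL₂(F) ⋊ Aut(F)`. -/
abbrev SigmaSL (F : Type*) [Field F] :=
  Matrix.SpecialLinearGroup (Fin 2) F ⋊[ringAutSL F] RingAut F

/-- The action of `SL₂(F) ⋊ Aut(F)` on `F²` by semilinear maps. -/
def SigmaSL.act (γ : SigmaSL F) (x : F × F) : F × F :=
  (γ.left 0 0 * γ.right x.1 + γ.left 0 1 * γ.right x.2,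
    γ.left 1 0 * γ.right x.1 + γ.left 1 1 * γ.right x.2)

theorem SigmaSL.act_one (x : F × F) : SigmaSL.act (1 : SigmaSL F) x = x := by
  simp [SigmaSL.act]

theorem SigmaSL.act_mul (γ δ : SigmaSL F) (x : F × F) : (γ * δ).act x = γ.act (δ.act x) := by
  simp only [act, SemidirectProduct.mul_left, SemidirectProduct.mul_right,
    Matrix.SpecialLinearGroup.coe_mul, Matrix.mul_apply, Fin.sum_univ_two, ringAutSL,
    MonoidHom.coe_mk, OneHom.coe_mk, slCongr_apply, map_add, map_mul, RingAut.mul_apply,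
    Prod.mk.injEq]
  constructor <;> ring

theorem SigmaSL.act_neg (γ : SigmaSL F) (x : F × F) : γ.act (-x) = -γ.act x := by
  ext <;> simp [act] <;> ring

theorem SigmaSL.act_inv_act (γ : SigmaSL F) (x : F × F) : γ⁻¹.act (γ.act x) = x := by
  rw [← act_mul, inv_mul_cancel, act_one]

theorem SigmaSL.act_act_inv (γ : SigmaSL F) (x : F × F) : γ.act (γ⁻¹.act x) = x := by
  rw [← act_mul, mul_inv_cancel, act_one]

theorem SigmaSL.act_injective : Function.Injective (SigmaSL.act (F := F)) := by
  intro γ δ h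
  have h1 := congrFun h (1, 0)
  have h2 := congrFun h (0, 1)
  simp only [act, map_one, map_zero, mul_one, mul_zero, add_zero, zero_add, Prod.mk.injEq] at h1 h2
  have hleft : γ.left = δ.left := by
    ext i j
    fin_cases i <;> fin_cases j <;> simp [h1, h2]
  refine SemidirectProduct.ext hleft ?_
  ext x
  have h3 := congrFun h (x, 0)
  simp only [act, map_zero, mul_zero, add_zero, Prod.mk.injEq, hleft] at h3
  -- The difference of the two field automorphisms at x is killed by both entries of the first
  -- column, hence by the determinant, which is 1.
  have hdet := δ.left.det_coe
  rw [Matrix.det_fin_two] at hdet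
  linear_combination (δ.left 1 1) * h3.1 - δ.left 0 1 * h3.2 - (γ.right x - δ.right x) * hdet

/-- The semilinear map of `F²` that consists of a matrix of determinant `1` and a field
automorphism. -/
def SigmaSL.mk' (a b c d : F) (h : a * d - b * c = 1) (θ : RingAut F) : SigmaSL F :=
  ⟨⟨!![a, b; c, d], by rw [Matrix.det_fin_two_of, h]⟩, θ⟩

theorem SigmaSL.act_mk' (a b c d : F) (h : a * d - b * c = 1) (θ : RingAut F) (x : F × F) :
    (SigmaSL.mk' a b c d h θ).act x = (a * θ x.1 + b * θ x.2, c * θ x.1 + d * θ x.2) := by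
  simp [act, mk']

theorem eq_of_lineSet_subset {i j : Option F} (hij : lineSet i ⊆ lineSet j) : i = j := by
  cases i with
  | none =>
    cases j with
    | none => rfl
    | some m =>
      have : ((0, 1) : F × F) ∈ lineSet (some m) := hij (by simp [lineSet])
      simp [lineSet] at this
  | some m =>
    have : ((1, m) : F × F) ∈ lineSet j := hij (by simp [lineSet])
    cases j with
    | none => simp [lineSet] at this
    | some m' => simpa [lineSet] using this

theorem SigmaSL.exists_image_lineSet (γ : SigmaSL F) (i : Option F) :
    ∃ j, γ.act '' lineSet i = lineSet j := by
  have key : ∀ (γ : SigmaSL F) (i : Option F), ∃ j, ∀ x ∈ lineSet i, γ.act x ∈ lineSet j := by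
    intro γ i
    have hdet := γ.left.det_coe
    rw [Matrix.det_fin_two] at hdet
    obtain ⟨a, b, hab⟩ : ∃ a b : F, ∀ x ∈ lineSet i, ∃ t, γ.act x = (t * a, t * b) := by
      cases i with
      | none =>
        refine ⟨γ.left 0 1, γ.left 1 1, ?_⟩
        rintro ⟨x, y⟩ hx
        obtain rfl : x = 0 := hx
        exact ⟨γ.right y, by simp [act, mul_comm]⟩
      | some m =>
        refine ⟨γ.left 0 0 + γ.left 0 1 * γ.right m, γ.left 1 0 + γ.left 1 1 * γ.right m, ?_⟩
        rintro ⟨x, y⟩ hx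
        obtain rfl : y = m * x := hx
        refine ⟨γ.right x, ?_⟩
        ext <;> simp [act] <;> ring
    by_cases ha : a = 0
    · refine ⟨none, fun x hx => ?_⟩
      obtain ⟨t, ht⟩ := hab x hx
      simp [lineSet, ht, ha]
    · refine ⟨some (b / a), fun x hx => ?_⟩
      obtain ⟨t, ht⟩ := hab x hx
      simp only [lineSet, ht, Set.mem_ofPred_eq]
      field_simp
  -- Inclusions suffice: following γ by its inverse maps line i into line k, hence i = k and both
  -- inclusions are equalities.
  obtain ⟨j, hj⟩ := key γ i
  obtain ⟨k, hk⟩ := key γ⁻¹ j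
  obtain rfl : i = k := eq_of_lineSet_subset fun x hx => by
    have := hk _ (hj x hx)
    rwa [act_inv_act] at this
  refine ⟨j, Set.Subset.antisymm (Set.image_subset_iff.2 hj) fun x hx => ?_⟩
  exact ⟨_, hk x hx, act_act_inv γ x⟩

/-- The direction of the `1`-space of `F²` with a given index. -/
def lineVec : Option F → F × F
  | none => (0, 1)
  | some m => (1, m)

theorem mem_lineSet_iff (i : Option F) (x : F × F) :
    x ∈ lineSet i ↔ x.1 * (lineVec i).2 = x.2 * (lineVec i).1 := by
  cases i with
  | none => simp [lineSet, lineVec]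
  | some m => simp [lineSet, lineVec, eq_comm, mul_comm]

theorem exists_act_lineSet {i j : Option F} (hij : i ≠ j) :
    ∃ γ : SigmaSL F, γ.act '' lineSet i = lineSet none ∧ γ.act '' lineSet j = lineSet (some 0) := by
  have hD : (lineVec j).1 * (lineVec i).2 - (lineVec j).2 * (lineVec i).1 ≠ 0 := by
    intro h
    apply hij
    cases i <;> cases j <;> simp_all [lineVec, sub_eq_zero]
  set D := (lineVec j).1 * (lineVec i).2 - (lineVec j).2 * (lineVec i).1 with hDdef
  -- The rows are linear forms that vanish on line i and on line j; dividing the second by D makes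
  -- the determinant 1.
  let γ : SigmaSL F := SigmaSL.mk' (lineVec i).2 (-(lineVec i).1) (-(lineVec j).2 / D)
    ((lineVec j).1 / D) (by field_simp; rw [hDdef]; ring) 1
  have hmem : ∀ x, (x ∈ lineSet i → γ.act x ∈ lineSet none) ∧
      (x ∈ lineSet j → γ.act x ∈ lineSet (some 0)) := by
    intro x
    refine ⟨fun hx => ?_, fun hx => ?_⟩
    · rw [mem_lineSet_iff] at hx
      simp only [γ, SigmaSL.act_mk', lineSet, Set.mem_ofPred_eq, RingAut.one_apply]
      linear_combination hx
    · rw [mem_lineSet_iff] at hx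
      simp only [γ, SigmaSL.act_mk', lineSet, Set.mem_ofPred_eq, RingAut.one_apply, zero_mul]
      field_simp
      linear_combination -hx
  have hne : ∀ i : Option F, lineVec i ∈ lineSet i ∧ lineVec i ≠ 0 := by
    intro i; cases i <;> simp [lineVec, lineSet]
  have hact0 : ∀ x, γ.act x = 0 → x = 0 := by
    intro x hx
    rw [← γ.act_inv_act x, hx]
    simp [SigmaSL.act]
  have huniq : ∀ (x : F × F) (k l : Option F), x ≠ 0 → x ∈ lineSet k → x ∈ lineSet l → k = l := by
    rintro ⟨x, y⟩ k l hx hk hl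
    cases k <;> cases l <;> simp_all [lineSet]
  obtain ⟨k, hk⟩ := γ.exists_image_lineSet i
  obtain ⟨l, hl⟩ := γ.exists_image_lineSet j
  refine ⟨γ, ?_, ?_⟩
  · rw [hk, huniq _ k none (fun h => (hne i).2 (hact0 _ h)) (hk ▸ ⟨_, (hne i).1, rfl⟩)
      ((hmem _).1 (hne i).1)]
  · rw [hl, huniq _ l (some 0) (fun h => (hne j).2 (hact0 _ h)) (hl ▸ ⟨_, (hne j).1, rfl⟩)
      ((hmem _).2 (hne j).1)]

end SemilinearGroup

/-! ### Lifting semilinear maps to projective maps -/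

section Framed

variable {F : Type*} [Field F] [Fintype F] [DecidableEq F]
variable {χ : AddChar F ℂ} {g : F → F → ℂ} {B : Option F → F → F → ℂ}

/-- Bruhat decomposition. A matrix with upper right entry 0 is a lower transvection times a diagonal
matrix; any other one is a lower transvection, a diagonal matrix, the Fourier rotation and a lower
transvection. Since a substitution by θ acts on F² through the inverse of θ, the field automorphism
enters as `γ.right⁻¹`. -/
theorem IsFramed.exists_covers (h : IsFramed χ g B) (γ : SigmaSL F) :
    ∃ U, Covers χ (projMap U) γ.act := by
  suffices ∃ f, (∃ U, Covers χ (projMap U) f) ∧ f = γ.act by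
    obtain ⟨f, hf, rfl⟩ := this; exact hf
  have hmul : ∀ {f f' : F × F → F × F}, (∃ U, Covers χ (projMap U) f) →
      (∃ U, Covers χ (projMap U) f') → ∃ U, Covers χ (projMap U) (f ∘ f') := by
    rintro f f' ⟨U, hU⟩ ⟨V, hV⟩
    exact ⟨U * V, by rw [map_mul]; exact hU.mul hV⟩
  have hdet := γ.left.det_coe
  rw [Matrix.det_fin_two] at hdet
  have hs1 : ∀ y, (1 : RingAut F).symm y = y := fun _ => rfl
  have hs2 : ∀ y, (γ.right⁻¹).symm y = γ.right y := fun _ => rfl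
  by_cases hb : γ.left 0 1 = 0
  · have ha : γ.left 0 0 ≠ 0 := fun ha => by simp [ha, hb] at hdet
    refine ⟨_, hmul ⟨_, h.covers_diagEquiv (γ.left 1 0 / γ.left 0 0)⟩
      (hmul ⟨_, h.covers_substEquiv (Units.mk0 _ ha)⁻¹ 1⟩ ⟨_, h.covers_substEquiv 1 γ.right⁻¹⟩), ?_⟩
    have hd : γ.left 1 1 = (γ.left 0 0)⁻¹ := by
      rw [← mul_left_inj' ha, inv_mul_cancel₀ ha]
      linear_combination hdet + γ.left 1 0 * hb
    ext x
    · simp [SigmaSL.act, hb, hs1, hs2]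
    · simp [SigmaSL.act, hd, hs1, hs2]
      field_simp
      ring
  · refine ⟨_, hmul ⟨_, h.covers_diagEquiv (γ.left 1 1 / γ.left 0 1)⟩
      (hmul ⟨_, h.covers_substEquiv (Units.mk0 (-γ.left 0 1) (neg_ne_zero.2 hb))⁻¹ 1⟩
      (hmul ⟨_, covers_fourierEquiv h.primitive⟩
      (hmul ⟨_, h.covers_diagEquiv (γ.left 0 0 / γ.left 0 1)⟩
        ⟨_, h.covers_substEquiv 1 γ.right⁻¹⟩))), ?_⟩
    ext x
    · simp [SigmaSL.act, hs1, hs2]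
      field_simp
      ring
    · simp [SigmaSL.act, hs1, hs2]
      field_simp
      linear_combination γ.right x.1 * hdet

end Framed

/-! ### Linear automorphisms normalize the Weyl group -/

section Framed

variable {F : Type*} [Field F] [Fintype F] [DecidableEq F]
variable {χ : AddChar F ℂ} {g : F → F → ℂ} {B : Option F → F → F → ℂ}

/-- The `1`-space spanned by a standard basis vector. -/
noncomputable def stdPoint (u : F) : ℙ ℂ (F → ℂ) :=
  Projectivization.mk ℂ (Pi.single u 1) (by simp)

/-- The `1`-space spanned by a multiple of an additive character. -/
noncomputable def charPoint (χ : AddChar F ℂ) (k : F) : ℙ ℂ (F → ℂ) :=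
  Projectivization.mk ℂ (fun w => χ (k * w))
    (Function.ne_iff.2 ⟨0, by simp⟩)

theorem stdPoint_injective : Function.Injective (stdPoint (F := F)) := by
  intro u v huv
  obtain ⟨c, hc⟩ := (Projectivization.mk_eq_mk_iff' ℂ _ _ _ _).1 huv
  by_contra hne
  have := congrFun hc u
  simp [hne] at this

theorem charPoint_injective (hχ : χ.IsPrimitive) : Function.Injective (charPoint χ) := by
  intro u v huv
  obtain ⟨c, hc⟩ := (Projectivization.mk_eq_mk_iff' ℂ _ _ _ _).1 huv
  have h0 : c = 1 := by simpa using congrFun hc 0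
  refine hχ.eq_of_forall fun b => ?_
  have := congrFun hc b
  simp only [h0, one_smul] at this
  rw [mul_comm b, mul_comm b, this]

theorem weylPerm_stdPoint (χ : AddChar F ℂ) (x : F × F) (u : F) :
    weylPerm χ x (stdPoint u) = stdPoint (u + x.1) := by
  rw [stdPoint, stdPoint, weylPerm, projMap_mk, Projectivization.mk_eq_mk_iff']
  refine ⟨χ (x.2 * (u + x.1)), ?_⟩
  ext w
  by_cases hw : w = u + x.1
  · subst hw; simp
  · have : w - x.1 ≠ u := fun h => hw (by rw [← h, sub_add_cancel])
    simp [hw, this]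

theorem weylPerm_charPoint (χ : AddChar F ℂ) (x : F × F) (k : F) :
    weylPerm χ x (charPoint χ k) = charPoint χ (k + x.2) := by
  rw [charPoint, charPoint, weylPerm, projMap_mk, Projectivization.mk_eq_mk_iff']
  refine ⟨χ (-(k * x.1)), ?_⟩
  ext w
  simp only [Pi.smul_apply, smul_eq_mul, weyl_apply, ← AddChar.map_add_eq_mul]
  congr 1
  ring

theorem weylPerm_injective (hχ : χ.IsPrimitive) : Function.Injective (weylPerm χ) := by
  intro x y hxy
  have h1 := congrArg (fun σ => σ (stdPoint 0)) hxy
  have h2 := congrArg (fun σ => σ (charPoint χ 0)) hxy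
  simp only [weylPerm_stdPoint, weylPerm_charPoint, zero_add] at h1 h2
  exact Prod.ext (stdPoint_injective h1) (charPoint_injective hχ h2)

theorem IsFramed.mem_orthoframe_none_iff (h : IsFramed χ g B) {P : ℙ ℂ (F → ℂ)} :
    P ∈ orthoframe (B none) ↔ ∃ u, P = stdPoint u := by
  induction P using Projectivization.ind with
  | h v hv =>
    rw [h.mem_orthoframe_none]
    refine exists_congr fun u => ?_
    rw [stdPoint, Projectivization.mk_eq_mk_iff']
    exact ⟨fun ⟨c, _, hc⟩ => ⟨c, hc.symm⟩, fun ⟨c, hc⟩ =>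
      ⟨c, fun h0 => hv (by rw [← hc, h0, zero_smul]), hc.symm⟩⟩

/-- The polarization of g 0 is trivial. The character g 0 need not be 1, but it only shifts the
labels inside the basis 0. -/
theorem IsFramed.apply_zero_left (h : IsFramed χ g B) :
    ∃ k, ∀ w, g 0 w = χ (k * w) :=
  h.primitive.exists_eq
    { toFun := g 0
      map_zero_eq_one' := h.zero_right 0
      map_add_eq_mul' := fun a b => by rw [h.add]; simp }

theorem IsFramed.mem_orthoframe_zero_iff (h : IsFramed χ g B) {P : ℙ ℂ (F → ℂ)} :
    P ∈ orthoframe (B (some 0)) ↔ ∃ k, P = charPoint χ k := by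
  obtain ⟨k₀, hk₀⟩ := h.apply_zero_left
  induction P using Projectivization.ind with
  | h v hv =>
    rw [h.mem_orthoframe_some]
    simp only [hk₀, ← AddChar.map_add_eq_mul, ← add_mul, charPoint,
      Projectivization.mk_eq_mk_iff']
    constructor
    · rintro ⟨k, c, -, hc⟩
      exact ⟨k₀ + k, c, by ext w; simp [hc]⟩
    · rintro ⟨k, c, hc⟩
      refine ⟨k - k₀, c, fun h0 => hv (by rw [← hc, h0, zero_smul]), fun w => ?_⟩
      rw [← hc]
      simp

/-- The Weyl operator (1, 0) fixes every character point and no standard point. -/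
theorem IsFramed.orthoframe_none_ne_zero (h : IsFramed χ g B) :
    orthoframe (B none) ≠ orthoframe (B (some 0)) := by
  intro heq
  have h1 : stdPoint 0 ∈ orthoframe (B (some 0)) := heq ▸ h.mem_orthoframe_none_iff.2 ⟨0, rfl⟩
  obtain ⟨k, hk⟩ := h.mem_orthoframe_zero_iff.1 h1
  have := weylPerm_stdPoint χ (1, 0) 0
  rw [hk, weylPerm_charPoint] at this
  simp only [add_zero] at this
  rw [← hk] at this
  have := stdPoint_injective this
  simp at this

theorem IsFramed.image_weylPerm (h : IsFramed χ g B) (x : F × F) (i : Option F) :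
    weylPerm χ x '' orthoframe (B i) = orthoframe (B i) :=
  h.image_orthoframe (covers_weylPerm χ x) (Set.image_id _)

/-- A linear map that permutes the standard `1`-spaces and fixes the all-one vector up to scalars
is a scalar multiple of a permutation matrix. -/
theorem exists_perm_of_fixes {U : (F → ℂ) ≃ₗ[ℂ] (F → ℂ)}
    (h1 : ∀ u, ∃ u', projMap U (stdPoint u) = stdPoint u')
    (h2 : projMap U (charPoint χ 0) = charPoint χ 0) :
    ∃ (π : Equiv.Perm F) (c : ℂ), c ≠ 0 ∧ (∀ u, projMap U (stdPoint u) = stdPoint (π u)) ∧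
      ∀ v u, U v (π u) = c * v u := by
  choose π hπ using h1
  have hinj : Function.Injective π := by
    intro u v huv
    refine stdPoint_injective ((projMap U).injective ?_)
    rw [hπ, hπ, huv]
  have hex : ∀ u, ∃ c : ℂ, U (Pi.single u 1) = c • (Pi.single (π u) 1 : F → ℂ) := by
    intro u
    have := hπ u
    rw [stdPoint, stdPoint, projMap_mk, Projectivization.mk_eq_mk_iff'] at this
    obtain ⟨c, hc⟩ := this
    exact ⟨c, hc.symm⟩
  choose d hd using hex
  have hU : ∀ v u, U v (π u) = d u * v u := by
    intro v u
    have hv : v = ∑ i, v i • (Pi.single i 1 : F → ℂ) := by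
      ext w
      simp [Finset.sum_apply, Pi.single_apply]
    conv_lhs => rw [hv]
    simp only [map_sum, map_smul, hd, Finset.sum_apply, Pi.smul_apply, smul_eq_mul]
    rw [Finset.sum_eq_single u]
    · simp [mul_comm]
    · intro i _ hi
      have : π u ≠ π i := fun h => hi (hinj h).symm
      simp [this]
    · simp
  -- The point `charPoint χ 0` is spanned by the all-one vector; its image is constant, so all the
  -- nonzero entries of U agree.
  obtain ⟨c, hc⟩ : ∃ c : ℂ, ∀ w, U 1 w = c := by
    rw [charPoint, projMap_mk, Projectivization.mk_eq_mk_iff'] at h2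
    obtain ⟨c, hc⟩ := h2
    refine ⟨c, fun w => ?_⟩
    have := congrFun hc w
    simp only [zero_mul, AddChar.map_zero_eq_one, Pi.smul_apply, smul_eq_mul, mul_one] at this
    exact this.symm
  have hdc : ∀ u, d u = c := by
    intro u
    have := hU 1 u
    rw [hc] at this
    simpa using this.symm
  refine ⟨Equiv.ofBijective π (Finite.injective_iff_bijective.1 hinj), c, ?_, hπ, ?_⟩
  · rintro rfl
    have : U 1 = 0 := by ext w; exact hc w
    have := U.map_eq_zero_iff.1 this
    exact one_ne_zero this
  · intro v u
    change U v (π u) = _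
    rw [hU, hdc]

/-- A permutation of a finite field that permutes the bilinear forms `χ (m * x * y)` is the product
of a field automorphism and a multiplication. -/
theorem exists_semilinear (hχ : χ.IsPrimitive) (σ : Equiv.Perm F)
    (hadd : ∀ x y, σ (x + y) = σ x + σ y)
    (h : ∀ m, ∃ m', ∀ x y, χ (m * (σ x * σ y)) = χ (m' * x * y)) :
    ∃ (c : Fˣ) (θ : RingAut F), ∀ x, σ x = c * θ x := by
  -- The form χ (m' x y) takes the same value at (x y, 1) and at (x, y), for each m. So σ / σ 1 is
  -- multiplicative.
  have hmul : ∀ x y, σ (x * y) * σ 1 = σ x * σ y := by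
    intro x y
    refine hχ.eq_of_forall fun m => ?_
    obtain ⟨m', hm'⟩ := h m
    rw [hm', hm', mul_one, mul_assoc]
  have h0 : σ 0 = 0 := by simpa using hadd 0 0
  have h1 : σ 1 ≠ 0 := by
    rw [← h0]
    exact fun h => one_ne_zero (σ.injective h)
  let θ : F →+* F :=
    { toFun := fun x => (σ 1)⁻¹ * σ x
      map_one' := inv_mul_cancel₀ h1
      map_zero' := by simp [h0]
      map_add' := fun x y => by rw [hadd, mul_add]
      map_mul' := fun x y => by
        have := hmul x y
        field_simp
        linear_combination this }
  refine ⟨Units.mk0 (σ 1) h1,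
    RingEquiv.ofBijective θ (Finite.injective_iff_bijective.1 θ.injective), fun x => ?_⟩
  change σ x = σ 1 * ((σ 1)⁻¹ * σ x)
  rw [mul_inv_cancel_left₀ h1]

/-- Such a map is a scalar times a permutation. Preserving the frame 0 makes it permute the
characters, hence additive; permuting the remaining frames makes it permute the g m up to
characters, hence their polarizations χ (m x y), and `exists_semilinear` applies. -/
theorem IsFramed.exists_eq_substEquiv (h : IsFramed χ g B) {U : (F → ℂ) ≃ₗ[ℂ] (F → ℂ)}
    (hU : ∀ i, ∃ j, projMap U '' orthoframe (B i) = orthoframe (B j))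
    (hnone : projMap U '' orthoframe (B none) = orthoframe (B none))
    (hzero : projMap U '' orthoframe (B (some 0)) = orthoframe (B (some 0)))
    (hstd : projMap U (stdPoint 0) = stdPoint 0)
    (hchar : projMap U (charPoint χ 0) = charPoint χ 0) :
    ∃ c θ, projMap U = projMap (substEquiv c θ) := by
  obtain ⟨π, c, hc, hπ, hUv⟩ := exists_perm_of_fixes (U := U) (χ := χ) (fun u => by
    rw [← h.mem_orthoframe_none_iff, ← hnone]
    exact Set.mem_image_of_mem _ (h.mem_orthoframe_none_iff.2 ⟨u, rfl⟩)) hchar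
  have hπ0 : π 0 = 0 := stdPoint_injective (by rw [← hπ, hstd])
  have hσ : ∀ v x, U v x = c * v (π.symm x) := by
    intro v x
    rw [← hUv, Equiv.apply_symm_apply]
  have hσ0 : π.symm 0 = 0 := by rw [Equiv.symm_apply_eq, hπ0]
  have hchars : ∀ k, ∃ k', ∀ x, χ (k * π.symm x) = χ (k' * x) := by
    intro k
    have : projMap U (charPoint χ k) ∈ orthoframe (B (some 0)) :=
      hzero ▸ Set.mem_image_of_mem _ (h.mem_orthoframe_zero_iff.2 ⟨k, rfl⟩)
    obtain ⟨k', hk'⟩ := h.mem_orthoframe_zero_iff.1 this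
    rw [charPoint, charPoint, projMap_mk, Projectivization.mk_eq_mk_iff'] at hk'
    obtain ⟨d, hd⟩ := hk'
    have hd' : ∀ x, d * χ (k' * x) = c * χ (k * π.symm x) := fun x => by
      rw [← hσ (fun w => χ (k * w)), ← hd]; rfl
    have hdc : d = c := by simpa [hσ0] using hd' 0
    refine ⟨k', fun x => ?_⟩
    have := hd' x
    rw [hdc] at this
    exact (mul_left_cancel₀ hc this).symm
  have hquad : ∀ m, ∃ m' k, ∀ x, g m (π.symm x) = g m' x * χ (k * x) := by
    intro m
    have hv : (g m : F → ℂ) ≠ 0 := Function.ne_iff.2 ⟨0, h.ne_zero m 0⟩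
    have hmem : Projectivization.mk ℂ (g m) hv ∈ orthoframe (B (some m)) :=
      (h.mem_orthoframe_some m hv).2 ⟨0, 1, one_ne_zero, by simp⟩
    obtain ⟨j, hj⟩ := hU (some m)
    have hmem' := hj ▸ Set.mem_image_of_mem _ hmem
    rw [projMap_mk] at hmem'
    cases j with
    | none =>
      -- The frame ∞ is already its own image, so frame m would equal it; but g m has no zeros,
      -- unlike a multiple of a standard vector.
      rw [← hnone] at hj
      have := Set.image_injective.2 (projMap U).injective hj
      have hno := (h.mem_orthoframe_none hv).1 (this ▸ hmem)
      obtain ⟨k, d, hd, hk⟩ := hno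
      exfalso
      have := h.ne_zero m (k + 1)
      rw [hk] at this
      simp at this
    | some m' =>
      rw [h.mem_orthoframe_some] at hmem'
      obtain ⟨k, d, hd, hk⟩ := hmem'
      have hdc : d = c := by
        have := hk 0
        rw [hσ, hσ0, h.zero_right, h.zero_right] at this
        simpa using this.symm
      refine ⟨m', k, fun x => ?_⟩
      have := hk x
      rw [hσ, hdc] at this
      exact mul_left_cancel₀ hc this
  have hadd : ∀ x y, π.symm (x + y) = π.symm x + π.symm y := by
    intro x y
    refine h.primitive.eq_of_forall fun k => ?_
    obtain ⟨k', hk'⟩ := hchars k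
    rw [mul_add, AddChar.map_add_eq_mul, hk', hk', hk', mul_add, AddChar.map_add_eq_mul]
  obtain ⟨d, θ, hθ⟩ := exists_semilinear h.primitive π.symm hadd (by
    intro m
    obtain ⟨m', k, hm'⟩ := hquad m
    refine ⟨m', fun x y => ?_⟩
    have h1 := hm' (x + y)
    rw [hadd, h.add, h.add, hm', hm', mul_add, AddChar.map_add_eq_mul] at h1
    have := h.ne_zero m' x
    have := h.ne_zero m' y
    have := χ.apply_ne_zero (k * x)
    have := χ.apply_ne_zero (k * y)
    rw [← mul_assoc]
    refine mul_left_cancel₀ (a := g m' x * χ (k * x) * (g m' y * χ (k * y))) (by positivity) ?_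
    rw [h1]
    ring)
  refine ⟨d, θ, projMap_eq_of_smul c fun v => ?_⟩
  ext x
  rw [hσ, hθ]
  simp

/-- Every linear automorphism of the family of bases normalizes the Weyl group. -/
theorem IsFramed.exists_covers_of_permutes (h : IsFramed χ g B) {ψ : Equiv.Perm (ℙ ℂ (F → ℂ))}
    (hlin : ψ ∈ projGL F) (hψ : ∀ i, ∃ j, ψ '' orthoframe (B i) = orthoframe (B j)) :
    ∃ γ : SigmaSL F, Covers χ ψ γ.act := by
  obtain ⟨i, hi⟩ := hψ none
  obtain ⟨j, hj⟩ := hψ (some 0)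
  have hij : i ≠ j := by
    rintro rfl
    exact h.orthoframe_none_ne_zero (Set.image_injective.2 ψ.injective (hi.trans hj.symm))
  -- A lift V of γ brings the images of the frames ∞ and 0 back to their places.
  obtain ⟨γ, hγi, hγj⟩ := exists_act_lineSet hij
  obtain ⟨V, hV⟩ := h.exists_covers γ
  have hnone : (projMap V * ψ) '' orthoframe (B none) = orthoframe (B none) := by
    rw [Equiv.Perm.coe_mul, Set.image_comp, hi, h.image_orthoframe hV hγi]
  have hzero : (projMap V * ψ) '' orthoframe (B (some 0)) = orthoframe (B (some 0)) := by
    rw [Equiv.Perm.coe_mul, Set.image_comp, hj, h.image_orthoframe hV hγj]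
  obtain ⟨a, ha⟩ : ∃ a, (projMap V * ψ) (stdPoint 0) = stdPoint a := by
    rw [← h.mem_orthoframe_none_iff, ← hnone]
    exact Set.mem_image_of_mem _ (h.mem_orthoframe_none_iff.2 ⟨0, rfl⟩)
  obtain ⟨b, hb⟩ : ∃ b, (projMap V * ψ) (charPoint χ 0) = charPoint χ b := by
    rw [← h.mem_orthoframe_zero_iff, ← hzero]
    exact Set.mem_image_of_mem _ (h.mem_orthoframe_zero_iff.2 ⟨0, rfl⟩)
  -- The Weyl group moves the standard points by its first coordinate and the character points by
  -- its second, so one translation restores both base points.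
  set ρ := weylPerm χ (-a, -b) * (projMap V * ψ) with hρ
  obtain ⟨U, hU⟩ := mem_projGL_iff.1
    (mul_mem (projMap_mem_projGL (weyl χ (-a, -b))) (mul_mem (projMap_mem_projGL V) hlin))
  change projMap U = ρ at hU
  obtain ⟨c, θ, hcθ⟩ := h.exists_eq_substEquiv (U := U)
    (by
      intro k
      obtain ⟨l, hl⟩ := hψ k
      obtain ⟨m, hm⟩ := γ.exists_image_lineSet l
      refine ⟨m, ?_⟩
      rw [hU, hρ, Equiv.Perm.coe_mul, Equiv.Perm.coe_mul, Set.image_comp, Set.image_comp, hl,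
        h.image_orthoframe hV hm, h.image_weylPerm])
    (by rw [hU, hρ, Equiv.Perm.coe_mul, Set.image_comp, hnone, h.image_weylPerm])
    (by rw [hU, hρ, Equiv.Perm.coe_mul, Set.image_comp, hzero, h.image_weylPerm])
    (by rw [hU, hρ, Equiv.Perm.mul_apply, ha, weylPerm_stdPoint]; simp)
    (by rw [hU, hρ, Equiv.Perm.mul_apply, hb, weylPerm_charPoint]; simp)
  have h1 := h.covers_substEquiv c θ
  rw [← hcθ, hU] at h1
  let δ : SigmaSL F := SigmaSL.mk' (θ.symm (c⁻¹ : Fˣ)) 0 0 (θ.symm c)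
    (by rw [← map_mul]; simp) θ⁻¹
  have hδ : ∀ x, δ.act x = (θ.symm ((c⁻¹ : Fˣ) * x.1), θ.symm (c * x.2)) := by
    intro x
    simp only [δ, SigmaSL.act_mk', zero_mul, add_zero, zero_add, map_mul]
    rfl
  have h2 : Covers χ ρ δ.act := by rwa [funext hδ]
  have h3 : Covers χ ψ ((γ⁻¹).act ∘ id ∘ δ.act) := by
    have h4 : ψ = (projMap V)⁻¹ * ((weylPerm χ (-a, -b))⁻¹ * ρ) := by
      rw [hρ]; group
    rw [h4, ← weylPerm_neg]
    exact (hV.inv γ.act_act_inv).mul ((covers_weylPerm χ _).mul h2)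
  refine ⟨γ⁻¹ * δ, ?_⟩
  convert h3 using 1
  ext1 x
  exact SigmaSL.act_mul _ _ _

theorem IsFramed.permutes_of_covers (h : IsFramed χ g B) {ψ : Equiv.Perm (ℙ ℂ (F → ℂ))}
    {γ : SigmaSL F} (hψ : Covers χ ψ γ.act) (i : Option F) :
    ∃ j, ψ '' orthoframe (B i) = orthoframe (B j) := by
  obtain ⟨j, hj⟩ := γ.exists_image_lineSet i
  exact ⟨j, h.image_orthoframe hψ hj⟩

theorem IsFramed.permutes_conjPerm (h : IsFramed χ g B) (i : Option F) :
    ∃ j, conjPerm F '' orthoframe (B i) = orthoframe (B j) := by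
  refine ⟨i.map Neg.neg, h.image_orthoframe (covers_conjPerm χ) ?_⟩
  ext ⟨x, y⟩
  cases i with
  | none =>
    simp only [lineSet, Option.map_none, Set.mem_image, Set.mem_ofPred_eq, Prod.mk.injEq]
    exact ⟨fun ⟨z, hz, h1, _⟩ => by rw [← h1, hz], fun hx => ⟨(x, -y), hx, rfl, neg_neg y⟩⟩
  | some m =>
    simp only [lineSet, Option.map_some, Set.mem_image, Set.mem_ofPred_eq, Prod.mk.injEq]
    exact ⟨fun ⟨z, hz, h1, h2⟩ => by rw [← h1, ← h2, hz, neg_mul],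
      fun hx => ⟨(x, -y), by simp [hx], rfl, neg_neg y⟩⟩

/-- The centralizer of the Weyl group in `PGL` is the Weyl group. -/
theorem IsFramed.exists_eq_weylPerm (h : IsFramed χ g B) {ψ : Equiv.Perm (ℙ ℂ (F → ℂ))}
    (hlin : ψ ∈ projGL F) (hψ : Covers χ ψ id) : ∃ x, ψ = weylPerm χ x := by
  obtain ⟨a, ha⟩ : ∃ a, ψ (stdPoint 0) = stdPoint a := by
    rw [← h.mem_orthoframe_none_iff, h.mem_orthoframe_of_covers hψ (Set.image_id _)]
    exact h.mem_orthoframe_none_iff.2 ⟨0, rfl⟩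
  obtain ⟨b, hb⟩ : ∃ b, ψ (charPoint χ 0) = charPoint χ b := by
    rw [← h.mem_orthoframe_zero_iff, h.mem_orthoframe_of_covers hψ (Set.image_id _)]
    exact h.mem_orthoframe_zero_iff.2 ⟨0, rfl⟩
  set ρ := weylPerm χ (-a, -b) * ψ with hρ
  have hρcov : Covers χ ρ id := (covers_weylPerm χ _).mul hψ
  obtain ⟨U, hU⟩ := mem_projGL_iff.1 (mul_mem (projMap_mem_projGL (weyl χ (-a, -b))) hlin)
  change projMap U = ρ at hU
  -- The standard points form one orbit of the Weyl group, with which ρ commutes, and ρ fixes one of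
  -- them.
  have hstd : ∀ u, ρ (stdPoint u) = stdPoint u := by
    intro u
    have h1 : stdPoint u = weylPerm χ (u, 0) (stdPoint 0) := by rw [weylPerm_stdPoint, zero_add]
    rw [h1, ← Equiv.Perm.mul_apply, hρcov, Equiv.Perm.mul_apply, hρ, Equiv.Perm.mul_apply, ha,
      weylPerm_stdPoint, weylPerm_stdPoint, weylPerm_stdPoint]
    simp
  obtain ⟨π, c, hc, hπ, hUv⟩ := exists_perm_of_fixes (U := U) (χ := χ)
    (fun u => ⟨u, by rw [hU, hstd]⟩)
    (by rw [hU, hρ, Equiv.Perm.mul_apply, hb, weylPerm_charPoint]; simp)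
  have hπ1 : ∀ u, π u = u := fun u => stdPoint_injective (by rw [← hπ, hU, hstd])
  have hρ1 : ρ = 1 := by
    rw [← hU, ← map_one projMap]
    refine projMap_eq_of_smul c fun v => ?_
    ext u
    have := hUv v u
    rwa [hπ1] at this
  refine ⟨(a, b), ?_⟩
  have h5 : weylPerm χ (a, b) = (weylPerm χ (-a, -b))⁻¹ := by
    rw [← weylPerm_neg]; simp
  rw [h5]
  exact eq_inv_of_mul_eq_one_right hρ1

/-- A linear U inducing τ would scale e₀, e₁ and e₀ + e₁ by one common factor a, and e₀ + i e₁ would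
then give -i a = i a. -/
theorem conjPerm_notMem_projGL : conjPerm F ∉ projGL F := by
  intro hmem
  obtain ⟨U, hU⟩ := mem_projGL_iff.1 hmem
  have key : ∀ v : F → ℂ, v ≠ 0 → ∃ c : ℂ, c • conjLin F v = U v := by
    intro v hv
    have := congrArg (fun σ => σ (Projectivization.mk ℂ v hv)) hU
    simpa only [projMap_mk, conjPerm_mk, Projectivization.mk_eq_mk_iff'] using this
  have hne : ∀ c : ℂ, (Pi.single (0 : F) (1 : ℂ) + c • Pi.single (1 : F) (1 : ℂ) : F → ℂ) ≠ 0 :=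
    fun c => Function.ne_iff.2 ⟨0, by simp⟩
  obtain ⟨a, ha⟩ := key _ (hne 0)
  obtain ⟨b, hb⟩ := key (Pi.single 1 1) (by simp)
  obtain ⟨c, hc⟩ := key _ (hne 1)
  obtain ⟨d, hd⟩ := key _ (hne Complex.I)
  have hconj : ∀ u : F, conjLin F (Pi.single u 1) = Pi.single u 1 := by
    intro u
    ext w
    by_cases hw : w = u
    · subst hw; simp [conjLin]
    · simp [conjLin, hw]
  simp only [map_add, map_smul, LinearMap.map_smulₛₗ, hconj, zero_smul, add_zero, one_smul, Complex.conj_I] at ha hb hc hd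
  rw [← ha, ← hb] at hc hd
  have c0 := congrFun hc 0
  have c1 := congrFun hc 1
  have d0 := congrFun hd 0
  have d1 := congrFun hd 1
  simp at c0 c1 d0 d1
  have ha0 : a ≠ 0 := by
    rintro rfl
    rw [zero_smul] at ha
    have := U.map_eq_zero_iff.1 ha.symm
    simp at this
  have : (2 * Complex.I) * a = 0 := by
    rw [d0, ← c1, c0] at d1
    linear_combination -d1
  simp [ha0] at this

end Framed

/-! ### Splitting criteria for group extensions -/

section Extensions

variable {N G Q : Type*} [Group N] [Group G] [Group Q]

theorem GroupExtension.nonempty_splitting_of_subgroup (E : GroupExtension N G Q) (C : Subgroup G)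
    (hinj : ∀ c ∈ C, E.rightHom c = 1 → c = 1) (hsurj : ∀ q, ∃ c ∈ C, E.rightHom c = q) :
    Nonempty E.Splitting := by
  have hbij : Function.Bijective (E.rightHom.comp C.subtype) := by
    constructor
    · rw [injective_iff_map_eq_one]
      exact fun c hc => Subtype.ext (hinj c c.2 hc)
    · intro q
      obtain ⟨c, hc, hq⟩ := hsurj q
      exact ⟨⟨c, hc⟩, hq⟩
  let e := MulEquiv.ofBijective _ hbij
  exact ⟨{ toMonoidHom := C.subtype.comp e.symm.toMonoidHom
           rightInverse_rightHom := fun q => e.apply_symm_apply q }⟩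

theorem GroupExtension.nonempty_splitting_of_isComplement' (E : GroupExtension N G Q)
    {C : Subgroup G} (hC : E.inl.range.IsComplement' C) : Nonempty E.Splitting := by
  refine E.nonempty_splitting_of_subgroup C (fun c hc h1 => ?_) fun q => ?_
  · have : c ∈ E.inl.range := by rw [E.range_inl_eq_ker_rightHom]; exact h1
    exact Subgroup.disjoint_def.1 hC.disjoint this hc
  · obtain ⟨x, rfl⟩ := E.rightHom_surjective q
    obtain ⟨⟨⟨n, hn⟩, ⟨c, hc⟩⟩, hx⟩ := hC.2 x
    refine ⟨c, hc, ?_⟩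
    have h1 : E.rightHom n = 1 := by
      rw [← MonoidHom.mem_ker, ← E.range_inl_eq_ker_rightHom]; exact hn
    rw [← hx]
    simp [h1]

open Classical in
/-- The extension given by a subgroup of index two. -/
noncomputable def GroupExtension.ofIndexTwo (H : Subgroup G) (hH : H.index = 2) :
    GroupExtension H G (Multiplicative (ZMod 2)) where
  inl := H.subtype
  rightHom := MonoidHom.mk' (fun x => if x ∈ H then 1 else Multiplicative.ofAdd 1) (by
    intro a b
    rw [Subgroup.mul_mem_iff_of_index_two hH]
    by_cases ha : a ∈ H <;> by_cases hb : b ∈ H <;> simp [ha, hb]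
    rfl)
  inl_injective := Subtype.val_injective
  range_inl_eq_ker_rightHom := by
    ext x
    simp [MonoidHom.mem_ker]
  rightHom_surjective := by
    intro z
    obtain ⟨a, ha⟩ : ∃ a, a ∉ H := by
      by_contra! h
      rw [(Subgroup.eq_top_iff' H).2 h, Subgroup.index_top] at hH
      omega
    have hz : z = 1 ∨ z = Multiplicative.ofAdd 1 := by revert z; decide
    rcases hz with rfl | rfl
    · exact ⟨1, map_one _⟩
    · exact ⟨a, by simp [ha]⟩

theorem GroupExtension.ofIndexTwo_splitting (H : Subgroup G) (hH : H.index = 2) {a : G}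
    (ha : a ∉ H) (ha2 : a * a = 1) : Nonempty (GroupExtension.ofIndexTwo H hH).Splitting := by
  have hinv : a⁻¹ = a := inv_eq_of_mul_eq_one_left ha2
  let C : Subgroup G :=
    { carrier := {1, a}
      one_mem' := Or.inl rfl
      mul_mem' := by
        rintro x y (rfl | rfl) (rfl | rfl) <;> simp [ha2]
      inv_mem' := by
        rintro x (rfl | rfl) <;> simp [hinv] }
  refine GroupExtension.nonempty_splitting_of_subgroup _ C ?_ ?_
  · rintro x (rfl | rfl) hx
    · rfl
    · simp [GroupExtension.ofIndexTwo, ha] at hx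
  · intro z
    have hz : z = 1 ∨ z = Multiplicative.ofAdd 1 := by revert z; decide
    rcases hz with rfl | rfl
    · exact ⟨1, Or.inl rfl, map_one _⟩
    · exact ⟨a, Or.inr rfl, by simp [GroupExtension.ofIndexTwo, ha]⟩

/-- A normal elementary subgroup of odd order is complemented by the centralizer of an element that
inverts it and centralizes the quotient. -/
theorem isComplement'_centralizer {F : Type*} [Field F] (h2 : (2 : F) ≠ 0)
    (w : Multiplicative (F × F) →* G) (hw : Function.Injective w) (P : G)
    (hP : ∀ x, P * w x = w x⁻¹ * P) (hcomm : ∀ a, ∃ x, a * P = w x * P * a) :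
    w.range.IsComplement' (Subgroup.centralizer {P}) := by
  have key : ∀ x : F × F, x + x = 0 → x = 0 := by
    intro x hx
    rw [← two_smul F, smul_eq_zero] at hx
    exact hx.resolve_left h2
  refine Subgroup.isComplement'_of_disjoint_and_mul_eq_univ ?_ ?_
  · rw [Subgroup.disjoint_def]
    rintro _ ⟨x, rfl⟩ hx
    have h3 : P * w x = w x * P := Subgroup.mem_centralizer_singleton_iff.1 hx |>.symm
    rw [hP, mul_left_inj, hw.eq_iff, inv_eq_iff_mul_eq_one] at h3
    have : x = 1 := key _ h3
    rw [this, map_one]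
  · rw [Set.eq_univ_iff_forall]
    intro a
    obtain ⟨x, hx⟩ := hcomm a
    -- Halving the discrepancy x works because passing P across w y inverts it, so that w y⁻¹ * a
    -- commutes with P exactly when w x is the square of w y.
    let y : Multiplicative (F × F) := Multiplicative.ofAdd ((2 : F)⁻¹ • x.toAdd)
    have hy : y * y = x := by
      change (2 : F)⁻¹ • x.toAdd + (2 : F)⁻¹ • x.toAdd = x.toAdd
      rw [← add_smul, ← two_mul, mul_inv_cancel₀ h2, one_smul]
    refine ⟨w y, ⟨y, rfl⟩, (w y)⁻¹ * a, ?_, by simp⟩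
    rw [SetLike.mem_coe, Subgroup.mem_centralizer_singleton_iff, mul_assoc, hx, ← hy, map_mul,
      ← map_inv, ← mul_assoc P, hP, inv_inv, map_inv]
    group

end Extensions

/-! ### The automorphism group as an iterated extension -/

section Framed

variable {F : Type*} [Field F] [Fintype F] [DecidableEq F]
variable {χ : AddChar F ℂ} {g : F → F → ℂ} {B : Option F → F → F → ℂ}

/-- The subgroup of the elements of the automorphism group that are induced by linear maps. -/
noncomputable def linAut (B : Option F → F → F → ℂ) : Subgroup (mubAut B) :=
  (projGL F).comap ((projGLPlus F).subtype.comp (mubAut B).subtype)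

/-- The element of the automorphism group given by a linear map. -/
noncomputable def linAut.mk (ψ : Equiv.Perm (ℙ ℂ (F → ℂ))) (hψ : ψ ∈ projGL F)
    (h : ∀ i, ∃ j, ψ '' orthoframe (B i) = orthoframe (B j)) : linAut B :=
  ⟨⟨⟨ψ, mem_projGLPlus_iff.2 (Or.inl hψ)⟩, h⟩, hψ⟩

theorem linAut.ext {a b : linAut B} (h : a.1.1.1 = b.1.1.1) : a = b :=
  Subtype.ext (Subtype.ext (Subtype.ext h))

/-- The conjugation map as an element of the automorphism group. -/
noncomputable def IsFramed.conjAut (h : IsFramed χ g B) : mubAut B :=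
  ⟨⟨conjPerm F, mem_projGLPlus_iff.2 (Or.inr (by rw [conjPerm_mul_self]; exact one_mem _))⟩,
    h.permutes_conjPerm⟩

theorem IsFramed.conjAut_mul_self (h : IsFramed χ g B) : h.conjAut * h.conjAut = 1 :=
  Subtype.ext (Subtype.ext conjPerm_mul_self)

theorem IsFramed.conjAut_notMem (h : IsFramed χ g B) : h.conjAut ∉ linAut B :=
  conjPerm_notMem_projGL

theorem IsFramed.index_linAut (h : IsFramed χ g B) : (linAut B).index = 2 := by
  rw [Subgroup.index_eq_two_iff_exists_notMem_and]
  exact ⟨h.conjAut, h.conjAut_notMem, fun b => (mem_projGLPlus_iff.1 b.1.2).symm⟩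

/-- The Weyl group as a subgroup of the automorphism group. -/
noncomputable def IsFramed.weylHom (h : IsFramed χ g B) :
    Multiplicative (F × F) →* linAut B :=
  MonoidHom.mk' (fun x => linAut.mk (weylPerm χ x.toAdd) (projMap_mem_projGL _)
    fun i => ⟨i, h.image_weylPerm _ i⟩) fun x y => linAut.ext (weylPerm_add χ x.toAdd y.toAdd)

theorem IsFramed.weylHom_injective (h : IsFramed χ g B) : Function.Injective h.weylHom := by
  intro x y hxy
  exact weylPerm_injective h.primitive (congrArg (fun a => a.1.1.1) hxy)

theorem IsFramed.exists_covers_linAut (h : IsFramed χ g B) (a : linAut B) :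
    ∃ γ : SigmaSL F, Covers χ a.1.1.1 γ.act :=
  h.exists_covers_of_permutes a.2 a.1.2

theorem Covers.congr {ψ : Equiv.Perm (ℙ ℂ (F → ℂ))} {f f' : F × F → F × F}
    (h : Covers χ ψ f) (hf : ∀ x, f' x = f x) : Covers χ ψ f' := by
  rwa [show f' = f from funext hf]

theorem Covers.eq {ψ : Equiv.Perm (ℙ ℂ (F → ℂ))} {f f' : F × F → F × F} (hχ : χ.IsPrimitive)
    (h : Covers χ ψ f) (h' : Covers χ ψ f') : f = f' := by
  ext1 x
  refine weylPerm_injective hχ ?_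
  have := (h x).symm.trans (h' x)
  exact mul_right_cancel this

/-- The homomorphism from the linear automorphism group to `SL₂(F) ⋊ Aut(F)` given by the
conjugation action on the Weyl group. -/
noncomputable def IsFramed.symplecticHom (h : IsFramed χ g B) : linAut B →* SigmaSL F :=
  MonoidHom.mk' (fun a => (h.exists_covers_linAut a).choose) fun a b => by
    have ha := (h.exists_covers_linAut a).choose_spec
    have hb := (h.exists_covers_linAut b).choose_spec
    have hab := (h.exists_covers_linAut (a * b)).choose_spec
    refine SigmaSL.act_injective (hab.eq h.primitive
      ((ha.mul hb).congr (SigmaSL.act_mul _ _)))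

theorem IsFramed.covers_symplecticHom (h : IsFramed χ g B) (a : linAut B) :
    Covers χ a.1.1.1 (h.symplecticHom a).act :=
  (h.exists_covers_linAut a).choose_spec

theorem IsFramed.symplecticHom_eq (h : IsFramed χ g B) {a : linAut B} {γ : SigmaSL F}
    (ha : Covers χ a.1.1.1 γ.act) : h.symplecticHom a = γ :=
  SigmaSL.act_injective ((h.covers_symplecticHom a).eq h.primitive ha)

theorem IsFramed.exists_eq_weylHom (h : IsFramed χ g B) {a : linAut B}
    (ha : Covers χ a.1.1.1 id) : ∃ x, a = h.weylHom x := by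
  obtain ⟨x, hx⟩ := h.exists_eq_weylPerm a.2 ha
  exact ⟨Multiplicative.ofAdd x, linAut.ext hx⟩

/-- The linear automorphism group as an extension of `SL₂(F) ⋊ Aut(F)` by `F²`. -/
noncomputable def IsFramed.weylExtension (h : IsFramed χ g B) :
    GroupExtension (Multiplicative (F × F)) (linAut B) (SigmaSL F) where
  inl := h.weylHom
  rightHom := h.symplecticHom
  inl_injective := h.weylHom_injective
  range_inl_eq_ker_rightHom := by
    ext a
    rw [MonoidHom.mem_ker]
    constructor
    · rintro ⟨x, rfl⟩
      exact h.symplecticHom_eq ((covers_weylPerm χ x.toAdd).congr SigmaSL.act_one)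
    · intro ha
      have h1 := h.covers_symplecticHom a
      rw [ha, show (1 : SigmaSL F).act = id from funext SigmaSL.act_one] at h1
      obtain ⟨x, hx⟩ := h.exists_eq_weylHom h1
      exact ⟨x, hx.symm⟩
  rightHom_surjective := by
    intro γ
    obtain ⟨U, hU⟩ := h.exists_covers γ
    exact ⟨linAut.mk (projMap U) (projMap_mem_projGL U) (h.permutes_of_covers hU),
      h.symplecticHom_eq hU⟩

/-- Every element of the automorphism group acts additively on the Weyl group. -/
theorem IsFramed.exists_covers_mubAut (h : IsFramed χ g B) (a : mubAut B) :
    ∃ f f' : F × F → F × F, Covers χ a.1.1 f ∧ (∀ x, f (-x) = -f x) ∧ ∀ x, f (f' x) = x := by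
  by_cases ha : a ∈ linAut B
  · have := h.covers_symplecticHom ⟨a, ha⟩
    exact ⟨_, _, this, SigmaSL.act_neg _, SigmaSL.act_act_inv _⟩
  -- Outside the subgroup of index two, multiplication by τ leads back to the linear case.
  · have hb : a * h.conjAut ∈ linAut B := by
      rw [Subgroup.mul_mem_iff_of_index_two h.index_linAut]
      simp [ha, h.conjAut_notMem]
    have h1 := h.covers_symplecticHom ⟨_, hb⟩
    have h2 : Covers χ (a * h.conjAut * h.conjAut).1.1 _ := h1.mul (covers_conjPerm χ)
    rw [mul_assoc, h.conjAut_mul_self, mul_one] at h2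
    refine ⟨_, fun x => ((h.symplecticHom ⟨_, hb⟩)⁻¹.act x).1 |> fun y =>
      (y, -((h.symplecticHom ⟨_, hb⟩)⁻¹.act x).2), h2, fun x => ?_, fun x => ?_⟩
    · simp only [Function.comp_apply, ← SigmaSL.act_neg]
      rfl
    · simp [SigmaSL.act_act_inv]

theorem IsFramed.covers_substEquiv_neg_one (h : IsFramed χ g B) :
    Covers χ (projMap (substEquiv (-1) 1)) fun x => -x := by
  refine (h.covers_substEquiv (-1) 1).congr fun x => ?_
  ext <;> simp <;> rfl

/-- The map `v ↦ (w ↦ v (-w))` as an element of the automorphism group. -/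
noncomputable def IsFramed.parityAut (h : IsFramed χ g B) : linAut B :=
  linAut.mk (projMap (substEquiv (-1) 1)) (projMap_mem_projGL _) fun i =>
    ⟨i, h.image_orthoframe h.covers_substEquiv_neg_one (by
      ext x
      simp only [Set.mem_image]
      constructor
      · rintro ⟨y, hy, rfl⟩
        cases i <;> simp_all [lineSet]
      · intro hx
        refine ⟨-x, ?_, neg_neg x⟩
        cases i <;> simp_all [lineSet])⟩

theorem IsFramed.covers_parityAut (h : IsFramed χ g B) :
    Covers χ h.parityAut.1.1.1 fun x => -x :=
  h.covers_substEquiv_neg_one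

theorem IsFramed.parityAut_mul (h : IsFramed χ g B) (x : Multiplicative (F × F)) :
    h.parityAut * h.weylHom x = h.weylHom x⁻¹ * h.parityAut :=
  linAut.ext (h.covers_parityAut x.toAdd)

/-- Parity acts on F² as -1, which commutes with every action coming from the automorphism group.
The commutator with a is therefore a linear automorphism centralizing the Weyl group, hence a Weyl
operator. -/
theorem IsFramed.exists_mul_parityAut (h : IsFramed χ g B) (a : mubAut B) :
    ∃ x, a * h.parityAut = (h.weylHom x * h.parityAut : linAut B) * a := by
  have hnorm : (linAut B).Normal := Subgroup.normal_of_index_eq_two h.index_linAut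
  let b : linAut B :=
    ⟨a * h.parityAut * a⁻¹ * (h.parityAut⁻¹ : linAut B), mul_mem
      (hnorm.conj_mem _ h.parityAut.2 a) (h.parityAut⁻¹ : linAut B).2⟩
  obtain ⟨f, f', hf, hneg, hff'⟩ := h.exists_covers_mubAut a
  have hb : Covers χ b.1.1.1 id := by
    have h1 := ((hf.mul h.covers_parityAut).mul (hf.inv hff')).mul
      (h.covers_parityAut.inv (f' := fun x => -x) neg_neg)
    exact h1.congr fun x => by simp [hneg, hff']
  obtain ⟨x, hx⟩ := h.exists_eq_weylHom hb
  refine ⟨x, ?_⟩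
  rw [← hx]
  simp [b]

theorem IsFramed.normal_map_weylHom (h : IsFramed χ g B) :
    (h.weylHom.range.map (linAut B).subtype).Normal := by
  constructor
  rintro _ ⟨_, ⟨x, rfl⟩, rfl⟩ a
  obtain ⟨f, -, hf, -, -⟩ := h.exists_covers_mubAut a
  refine ⟨h.weylHom (Multiplicative.ofAdd (f x.toAdd)), ⟨_, rfl⟩, ?_⟩
  rw [eq_mul_inv_iff_mul_eq]
  exact Subtype.ext (Subtype.ext (hf x.toAdd).symm)

theorem IsFramed.exists_complement (h : IsFramed χ g B) (h2 : (2 : F) ≠ 0) :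
    ∃ C : Subgroup (mubAut B), (h.weylHom.range.map (linAut B).subtype).IsComplement' C := by
  refine ⟨Subgroup.centralizer {h.parityAut.1}, ?_⟩
  rw [← MonoidHom.range_comp]
  refine isComplement'_centralizer h2 ((linAut B).subtype.comp h.weylHom)
    (Subtype.val_injective.comp h.weylHom_injective) _ (fun x => ?_) fun a => ?_
  · exact congrArg Subtype.val (h.parityAut_mul x)
  · exact h.exists_mul_parityAut a

theorem IsFramed.weylExtension_splitting (h : IsFramed χ g B) (h2 : (2 : F) ≠ 0) :
    Nonempty h.weylExtension.Splitting := by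
  refine h.weylExtension.nonempty_splitting_of_isComplement'
    (isComplement'_centralizer h2 h.weylHom h.weylHom_injective h.parityAut h.parityAut_mul
      fun a => ?_)
  obtain ⟨x, hx⟩ := h.exists_mul_parityAut a
  exact ⟨x, Subtype.ext hx⟩

end Framed

/-! ### Non-splitting in characteristic two -/

section Framed

variable {F : Type*} [Field F] [Fintype F] [DecidableEq F]
variable {χ : AddChar F ℂ} {g : F → F → ℂ} {B : Option F → F → F → ℂ}

/-- The transvection `(a, b) ↦ (a, b + t * a)`. -/
def lowerSL (t : F) : SigmaSL F := SigmaSL.mk' 1 0 t 1 (by ring) 1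

theorem lowerSL_act (t : F) (x : F × F) : (lowerSL t).act x = (x.1, x.2 + t * x.1) := by
  simp [lowerSL, SigmaSL.act_mk', add_comm]

theorem lowerSL_mul (t u : F) : lowerSL t * lowerSL u = lowerSL (t + u) := by
  refine SigmaSL.act_injective (funext fun x => ?_)
  simp only [SigmaSL.act_mul, lowerSL_act, Prod.mk.injEq, true_and]
  ring

theorem lowerSL_zero : lowerSL (0 : F) = 1 := by
  refine SigmaSL.act_injective (funext fun x => ?_)
  simp [lowerSL_act, SigmaSL.act_one]

theorem IsFramed.diagEquiv_stdPoint (h : IsFramed χ g B) (t u : F) :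
    projMap (h.diagEquiv t) (stdPoint u) = stdPoint u := by
  rw [stdPoint, projMap_mk, Projectivization.mk_eq_mk_iff']
  refine ⟨g t u, ?_⟩
  ext w
  by_cases hw : w = u
  · subst hw; simp
  · simp [hw]

/-- A splitting gives, for every transvection, a translate of its standard lift. -/
theorem IsFramed.splitting_lowerSL (h : IsFramed χ g B) (s : h.weylExtension.Splitting) (t : F) :
    ∃ x, (s (lowerSL t)).1.1.1 = weylPerm χ x * projMap (h.diagEquiv t) := by
  have h1 : Covers χ (s (lowerSL t)).1.1.1 (lowerSL t).act := by
    have := h.covers_symplecticHom (s (lowerSL t))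
    rwa [show h.symplecticHom (s (lowerSL t)) = lowerSL t from s.rightHom_splitting _] at this
  have h2 := h1.mul ((h.covers_diagEquiv t).inv (f' := (lowerSL (-t)).act)
    (fun x => by simp [lowerSL_act]))
  obtain ⟨x, hx⟩ := h.exists_eq_weylPerm
    (mul_mem (s (lowerSL t)).2 (inv_mem (projMap_mem_projGL _)))
    (h2.congr fun x => by simp [lowerSL_act])
  exact ⟨x, (mul_inv_eq_iff_eq_mul.1 hx)⟩

/-- A section sends the transvection t to a Weyl operator x t times the diagonal operator D of g t.
The first coordinate of x t is additive in t, yet the relation that the lift squares to 1 makes its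
square equal to 1 / t. Additivity between 1, t and t + 1 then fails once q > 4. -/
theorem IsFramed.isEmpty_splitting (h : IsFramed χ g B) (h2 : (2 : F) = 0)
    (hq : 8 ≤ Fintype.card F) : IsEmpty h.weylExtension.Splitting := by
  constructor
  intro s
  have hdouble : ∀ y : F, y + y = 0 := fun y => by rw [← two_mul, h2, zero_mul]
  choose x hx using h.splitting_lowerSL s
  have hmul : ∀ t u, (s (lowerSL (t + u))).1.1.1 =
      (s (lowerSL t)).1.1.1 * (s (lowerSL u)).1.1.1 := by
    intro t u
    rw [← lowerSL_mul, map_mul]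
    rfl
  -- Diagonal operators fix the standard points, which see only the first coordinate.
  have hadd : ∀ t u, (x (t + u)).1 = (x t).1 + (x u).1 := by
    intro t u
    have := congrArg (fun σ => σ (stdPoint 0)) (hmul t u)
    simp only [hx, Equiv.Perm.mul_apply, h.diagEquiv_stdPoint, weylPerm_stdPoint, zero_add] at this
    rw [stdPoint_injective this, add_comm]
  have hsq : ∀ t, t ≠ 0 → t * (x t).1 ^ 2 = 1 := by
    intro t ht
    -- Since t + t = 0, the lift squares to 1. Moving D past the Weyl operator leaves the Weyl
    -- operator (0, t a) times D², where a = (x t).1.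
    have h3 := hmul t t
    rw [hdouble, lowerSL_zero, map_one, hx, mul_assoc, ← mul_assoc _ (weylPerm χ (x t)),
      h.covers_diagEquiv, mul_assoc (weylPerm χ _), ← mul_assoc, ← weylPerm_add] at h3
    have h4 := congrArg (fun σ => σ (charPoint χ 0)) h3
    rw [← map_mul] at h4
    have hroot : ∃ r, r ^ 2 = t := by
      have : CharP F 2 := CharTwo.of_one_ne_zero_of_two_eq_zero one_ne_zero h2
      obtain ⟨r, hr⟩ := (frobeniusEquiv F 2).surjective t
      exact ⟨r, hr⟩
    obtain ⟨r, hr⟩ := hroot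
    have hsquare : ∀ y, χ (y ^ 2) = χ y := by
      have : CharP F 2 := CharTwo.of_one_ne_zero_of_two_eq_zero one_ne_zero h2
      exact fun y => h.map_ringAut (frobeniusEquiv F 2) y
    -- With t = r², the polarization on the diagonal is χ ((r w)²) = χ (r w) by Frobenius
    -- invariance. Thus D² is multiplication by a nontrivial character.
    have hg2 : ∀ w, g t w * g t w = χ (r * w) := by
      intro w
      have h5 := h.add t w w
      rw [hdouble, h.zero_right, show t * w * w = (r * w) ^ 2 by rw [← hr]; ring, hsquare] at h5
      have h6 : χ (r * w) * χ (r * w) = 1 := by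
        rw [← AddChar.map_add_eq_mul, hdouble, AddChar.map_zero_eq_one]
      calc g t w * g t w = g t w * g t w * (χ (r * w) * χ (r * w)) := by rw [h6, mul_one]
        _ = g t w * g t w * χ (r * w) * χ (r * w) := by ring
        _ = χ (r * w) := by rw [← h5, one_mul]
    have h7 : projMap (h.diagEquiv t * h.diagEquiv t) (charPoint χ 0) = charPoint χ r := by
      rw [charPoint, charPoint, projMap_mk, Projectivization.mk_eq_mk_iff']
      refine ⟨1, ?_⟩
      ext w
      simp [hg2]
    simp only [Equiv.Perm.mul_apply, h7, weylPerm_charPoint] at h4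
    have h8 := charPoint_injective h.primitive h4
    simp only [Prod.snd_add] at h8
    have h9 : r = t * (x t).1 := by
      have := hdouble (x t).2
      linear_combination -h8 - this - hdouble (t * (x t).1)
    have hr0 : r ≠ 0 := by rintro rfl; exact ht (by rw [← hr]; ring)
    have h11 : r * r * (t * (x t).1 ^ 2) = r * r * 1 := by
      calc r * r * (t * (x t).1 ^ 2) = r ^ 2 * (x t).1 * (t * (x t).1) := by ring
        _ = r * r * 1 := by rw [hr, ← h9, mul_one]
    exact mul_left_cancel₀ (mul_ne_zero hr0 hr0) h11
  have hquad : ∀ t : F, t ≠ 0 → t ≠ 1 → t ^ 2 + t + 1 = 0 := by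
    intro t ht ht1
    have ht1' : t + 1 ≠ 0 := fun h0 => ht1 (by linear_combination h0 - h2)
    have e1 := hsq t ht
    have e2 := hsq 1 one_ne_zero
    have e3 := hsq (t + 1) ht1'
    rw [hadd] at e3
    -- Multiplying (t + 1) (a + b)² = 1 by t and inserting t a² = 1 and b² = 1 gives t = (t + 1)².
    linear_combination t * e3 - (t + 1) * e1 - t * (t + 1) * e2 -
      t * (t + 1) * (x t).1 * (x 1).1 * h2
  have hcard : Fintype.card F ≤ 4 := by
    by_contra! hlt
    obtain ⟨t, ht⟩ : ∃ t : F, t ∉ ({0, 1} : Finset F) := by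
      by_contra! hall
      have := Finset.card_le_card (fun t (_ : t ∈ Finset.univ) => hall t)
      rw [Finset.card_univ] at this
      have := this.trans Finset.card_le_two
      omega
    simp only [Finset.mem_insert, Finset.mem_singleton, not_or] at ht
    obtain ⟨u, hu⟩ : ∃ u : F, u ∉ ({0, 1, t, t + 1} : Finset F) := by
      by_contra! hall
      have := Finset.card_le_card (fun t (_ : t ∈ Finset.univ) => hall t)
      rw [Finset.card_univ] at this
      have := this.trans Finset.card_le_four
      omega
    simp only [Finset.mem_insert, Finset.mem_singleton, not_or] at hu
    have e1 := hquad t ht.1 ht.2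
    have e2 := hquad u hu.1 hu.2.1
    -- The roots of X² + X + 1 are t and t + 1, so there is no room for a fifth element u.
    have : (u - t) * (u - (t + 1)) = 0 := by
      linear_combination e2 + e1 - (u * t + u + 1) * h2
    rcases mul_eq_zero.1 this with h0 | h0
    · exact hu.2.2.1 (sub_eq_zero.1 h0)
    · exact hu.2.2.2 (sub_eq_zero.1 h0)
  omega

end Framed

/-! ### Assembling the extensions -/

section Main

universe v

variable {F : Type v} [Field F] [Fintype F] [DecidableEq F]
variable {χ : AddChar F ℂ} {g : F → F → ℂ} {B : Option F → F → F → ℂ}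

/-- The extension of a cyclic group of field automorphisms by `SL₂(F)`. -/
def SigmaSL.extension {r : ℕ} (e : RingAut F ≃* Multiplicative (ZMod r)) :
    GroupExtension (Matrix.SpecialLinearGroup (Fin 2) F) (SigmaSL F) (Multiplicative (ZMod r)) where
  inl := SemidirectProduct.inl
  rightHom := e.toMonoidHom.comp SemidirectProduct.rightHom
  inl_injective := SemidirectProduct.inl_injective
  range_inl_eq_ker_rightHom := by
    rw [SemidirectProduct.range_inl_eq_ker_rightHom]
    ext x
    simp [MonoidHom.mem_ker]
  rightHom_surjective := e.surjective.comp SemidirectProduct.rightHom_surjective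

/-- The canonical splitting of the extension of the field automorphisms by `SL₂(F)`. -/
def SigmaSL.splitting {r : ℕ} (e : RingAut F ≃* Multiplicative (ZMod r)) :
    (SigmaSL.extension e).Splitting where
  toMonoidHom := SemidirectProduct.inr.comp e.symm.toMonoidHom
  rightInverse_rightHom := fun z => by simp [extension]

theorem IsFramed.exists_extensions (h : IsFramed χ g B) {r : ℕ}
    (e : RingAut F ≃* Multiplicative (ZMod r)) :
    ∃ (H M : Type v) (_ : Group H) (_ : Group M)
      (E₁ : GroupExtension (Matrix.SpecialLinearGroup (Fin 2) F) H (Multiplicative (ZMod r)))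
      (E₂ : GroupExtension (Multiplicative (F × F)) M H)
      (E₃ : GroupExtension M (mubAut B) (Multiplicative (ZMod 2))),
      (E₂.inl.range.map E₃.inl).Normal ∧
      ((2 : F) ≠ 0 → Nonempty E₁.Splitting ∧ Nonempty E₂.Splitting ∧ Nonempty E₃.Splitting ∧
        ∃ C : Subgroup (mubAut B), (E₂.inl.range.map E₃.inl).IsComplement' C) ∧
      ((2 : F) = 0 → 8 ≤ Fintype.card F → IsEmpty E₂.Splitting) :=
  ⟨SigmaSL F, linAut B, inferInstance, inferInstance, SigmaSL.extension e, h.weylExtension,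
    GroupExtension.ofIndexTwo _ h.index_linAut, h.normal_map_weylHom,
    fun h2 => ⟨⟨SigmaSL.splitting e⟩, h.weylExtension_splitting h2,
      GroupExtension.ofIndexTwo_splitting _ _ h.conjAut_notMem h.conjAut_mul_self,
      h.exists_complement h2⟩,
    h.isEmpty_splitting⟩

end Main

/-! ### Finite fields and the classical bases in odd characteristic -/

section FiniteField

variable {F : Type*} [Field F] [Fintype F]

theorem finrank_eq_of_card_eq {p r : ℕ} [Fact p.Prime] [Algebra (ZMod p) F]
    (hq : Fintype.card F = p ^ r) : Module.finrank (ZMod p) F = r := by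
  have h := Module.card_eq_pow_finrank (K := ZMod p) (V := F)
  rw [hq, ZMod.card] at h
  exact (Nat.pow_right_injective (Fact.out : p.Prime).two_le h).symm

/-- Ring automorphisms of an algebra over a prime field are algebra automorphisms. -/
def ringAutEquivAlgEquiv (p : ℕ) [Algebra (ZMod p) F] : RingAut F ≃* (F ≃ₐ[ZMod p] F) where
  toFun θ := AlgEquiv.ofRingEquiv (f := θ) fun x => RingHom.congr_fun
    (Subsingleton.elim ((θ : F →+* F).comp (algebraMap (ZMod p) F)) (algebraMap (ZMod p) F)) x
  invFun θ := θ.toRingEquiv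
  left_inv _ := rfl
  right_inv _ := rfl
  map_mul' _ _ := rfl

/-- The Galois group over the prime field is cyclic of order equal to the degree, and every ring
automorphism fixes the prime field. -/
theorem nonempty_ringAut_mulEquiv {p r : ℕ} [Fact p.Prime] [Algebra (ZMod p) F]
    (hq : Fintype.card F = p ^ r) : Nonempty (RingAut F ≃* Multiplicative (ZMod r)) := by
  have hcard : Nat.card Gal(F/ZMod p) = r := by
    rw [IsGalois.card_aut_eq_finrank, finrank_eq_of_card_eq hq]
  have e := zmodCyclicMulEquiv (inferInstance : IsCyclic Gal(F/ZMod p))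
  rw [hcard] at e
  exact ⟨(ringAutEquivAlgEquiv p).trans e.symm⟩

theorem trace_ringAut {p : ℕ} [Fact p.Prime] [Algebra (ZMod p) F] (θ : RingAut F) (x : F) :
    Algebra.trace (ZMod p) F (θ x) = Algebra.trace (ZMod p) F x :=
  Algebra.trace_eq_of_algEquiv (ringAutEquivAlgEquiv p θ) x

variable [DecidableEq F]

theorem inv_sqrt_card_ne_zero : ((Real.sqrt (Fintype.card F) : ℝ) : ℂ)⁻¹ ≠ 0 := by
  have : (0 : ℝ) < Fintype.card F := Nat.cast_pos.2 Fintype.card_pos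
  exact inv_ne_zero (Complex.ofReal_ne_zero.2 (Real.sqrt_pos.2 this).ne')

theorem exists_isFramed_odd {p r : ℕ} [Fact p.Prime] [Algebra (ZMod p) F] (hp : p ≠ 2)
    {ω : ℂ} (hω : IsPrimitiveRoot ω p) :
    ∃ χ g, IsFramed χ g (classicalMUB (F := F) p r ω) := by
  have : NeZero p := ⟨(Fact.out : p.Prime).ne_zero⟩
  have hchar : CharP F p := charP_of_injective_algebraMap' (ZMod p) p
  have h2 : (2 : F) ≠ 0 := by
    intro h
    have h3 : ((2 : ℕ) : F) = 0 := by exact_mod_cast h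
    rw [CharP.cast_eq_zero_iff F p] at h3
    exact hp ((Nat.prime_dvd_prime_iff_eq Fact.out Nat.prime_two).1 h3)
  let ψ := AddChar.zmodChar p hω.pow_eq_one
  let χ : AddChar F ℂ := ψ.compAddMonoidHom (Algebra.trace (ZMod p) F).toAddMonoidHom
  have hχ : ∀ x, χ x = ω ^ (Algebra.trace (ZMod p) F x).val := fun x =>
    AddChar.zmodChar_apply hω.pow_eq_one _
  refine ⟨χ, fun m w => χ (2⁻¹ * (w * (w * m))), ?_, fun θ x => ?_, fun m w => ?_, fun m w w' => ?_,
    fun v => rfl, _, inv_sqrt_card_ne_zero (F := F), fun m v w => ?_⟩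
  · refine AddChar.IsPrimitive.of_ne_one ?_
    rw [AddChar.ne_one_iff]
    obtain ⟨b, hb⟩ := Algebra.trace_surjective (ZMod p) F 1
    refine ⟨b, ?_⟩
    rw [hχ, hb, ZMod.val_one_eq_one_mod, Nat.mod_eq_of_lt (Fact.out : p.Prime).one_lt, pow_one]
    exact hω.ne_one (Fact.out : p.Prime).one_lt
  · rw [hχ, hχ, trace_ringAut]
  · exact AddChar.apply_ne_zero _ _
  · rw [← AddChar.map_add_eq_mul, ← AddChar.map_add_eq_mul]
    congr 1
    field_simp
    ring
  · simp only [classicalMUB, if_neg hp, oddPhase]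
    rw [← AddChar.map_add_eq_mul, hχ]

end FiniteField

/-! ### Witt vector traces modulo 4 and the classical bases in characteristic two -/

section Even

open WittVector

variable {F : Type*} [Field F] [Fintype F] [CharP F 2]

/-- Such an x is a Verschiebung, Frobenius is surjective over a finite field, and their composite is
multiplication by 2. -/
theorem WittVector.exists_eq_two_mul {x : WittVector 2 F} (hx : x.coeff 0 = 0) :
    ∃ y, x = 2 * y := by
  have h1 : verschiebung (x.shift 1) = x := by
    have := verschiebung_shift x 0 (fun i hi => by rwa [Nat.lt_one_iff.1 hi])
    rw [this]
    ext n
    simp [shift]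
  obtain ⟨y, hy⟩ := (frobenius_bijective 2 F).2 (x.shift 1)
  refine ⟨y, ?_⟩
  rw [← h1, ← hy, verschiebung_frobenius, mul_comm]
  rfl

theorem WittVector.exists_teichmuller_add (x y : F) : ∃ z,
    teichmuller 2 (x + y) = teichmuller 2 x + teichmuller 2 y + 2 * z := by
  obtain ⟨z, hz⟩ := exists_eq_two_mul
    (x := teichmuller 2 (x + y) - (teichmuller 2 x + teichmuller 2 y)) (by
      have h := (constantCoeff : WittVector 2 F →+* F).map_sub (teichmuller 2 (x + y))
        (teichmuller 2 x + teichmuller 2 y)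
      rw [(constantCoeff : WittVector 2 F →+* F).map_add] at h
      refine h.trans ?_
      change (teichmuller 2 (x + y)).coeff 0 - ((teichmuller 2 x).coeff 0 +
        (teichmuller 2 y).coeff 0) = 0
      simp only [teichmuller_coeff_zero, sub_self])
  exact ⟨z, by rw [← hz]; ring⟩

theorem WittVector.truncate_four_mul (y : WittVector 2 F) :
    truncate 2 (4 * y) = 0 := by
  rw [← RingHom.mem_ker, mem_ker_truncate]
  intro i hi
  have := mul_pow_charP_coeff_zero (p := 2) y hi
  have h4 : 4 * y = y * ((2 : ℕ) : WittVector 2 F) ^ 2 := by push_cast; ring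
  rwa [h4]

/-- The coefficient 0 is k modulo 2; if k = 2 j, the coefficient 1 is the square of j modulo 2. So
ℤ/4 embeds in the truncated ring. -/
theorem WittVector.four_dvd_of_intCast_eq_zero {k : ℤ}
    (h : (k : TruncatedWittVector 2 2 F) = 0) : (4 : ℤ) ∣ k := by
  have h1 : ∀ i < 2, (k : WittVector 2 F).coeff i = 0 := by
    rw [← mem_ker_truncate, RingHom.mem_ker, map_intCast, h]
  have hcast : ∀ j : ℤ, (j : WittVector 2 F).coeff 0 = (j : F) := fun j =>
    map_intCast (constantCoeff : WittVector 2 F →+* F) j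
  have h2 := h1 0 (by norm_num)
  rw [hcast, CharP.intCast_eq_zero_iff F 2] at h2
  obtain ⟨j, rfl⟩ := h2
  have h3 := h1 1 (by norm_num)
  have h4 := mul_charP_coeff_succ (p := 2) (j : WittVector 2 F) 0
  have h5 : (((((2 : ℕ) : ℤ) * j : ℤ)) : WittVector 2 F) = j * ((2 : ℕ) : WittVector 2 F) := by
    push_cast; ring
  rw [h5, h4, hcast] at h3
  have h6 := pow_eq_zero_iff (two_ne_zero) |>.1 h3
  rw [CharP.intCast_eq_zero_iff F 2] at h6
  obtain ⟨l, rfl⟩ := h6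
  exact ⟨l, by push_cast; ring⟩

/-- The sum of the conjugates of a Witt vector under the first `r` powers of the Frobenius
endomorphism. -/
noncomputable def conjugateSum (r : ℕ) : WittVector 2 F →+ WittVector 2 F :=
  ∑ i ∈ Finset.range r,
    (((WittVector.frobenius : WittVector 2 F →+* WittVector 2 F) ^ i : WittVector 2 F →+* _) :
      WittVector 2 F →+ WittVector 2 F)

theorem conjugateSum_apply (r : ℕ) (x : WittVector 2 F) : conjugateSum r x =
    ∑ i ∈ Finset.range r, (WittVector.frobenius : WittVector 2 F →+* _)^[i] x := by
  simp [conjugateSum, RingHom.coe_pow]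

theorem galoisTrace_eq (r : ℕ) (x : WittVector 2 F) :
    galoisTrace r x = truncate 2 (conjugateSum r x) := by
  rw [conjugateSum_apply]; rfl

theorem conjugateSum_two_mul (r : ℕ) (x : WittVector 2 F) :
    conjugateSum r (2 * x) = 2 * conjugateSum r x := by
  rw [two_mul, two_mul, map_add]

theorem galoisTrace_add (r : ℕ) (x y : WittVector 2 F) :
    galoisTrace r (x + y) = galoisTrace r x + galoisTrace r y := by
  simp only [galoisTrace_eq, map_add]

theorem galoisTrace_four_mul (r : ℕ) (x : WittVector 2 F) : galoisTrace r (4 * x) = 0 := by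
  rw [galoisTrace_eq, show (4 : WittVector 2 F) * x = 2 * (2 * x) by ring, conjugateSum_two_mul,
    conjugateSum_two_mul, ← mul_assoc, show (2 : WittVector 2 F) * 2 = 4 by norm_num,
    truncate_four_mul]

/-- The r-th power of Frobenius raises each coefficient to the power q, so it is the identity and
Frobenius cyclically permutes the summands. -/
theorem frobenius_conjugateSum {r : ℕ} (hq : Fintype.card F = 2 ^ r) (x : WittVector 2 F) :
    WittVector.frobenius (conjugateSum r x) = conjugateSum r x := by
  simp only [conjugateSum_apply, map_sum]
  simp only [← Function.iterate_succ_apply' (⇑(WittVector.frobenius : WittVector 2 F →+* _))]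
  have h1 : (WittVector.frobenius : WittVector 2 F →+* _)^[r] x = x := by
    ext n
    rw [iterate_frobenius_coeff, ← hq, FiniteField.pow_card]
  have h2 := Finset.sum_range_succ
    (fun i => (WittVector.frobenius : WittVector 2 F →+* _)^[i] x) r
  rw [Finset.sum_range_succ', h1] at h2
  exact add_right_cancel h2

/-- The residue of y is fixed by squaring, so it is 0 or 1; as 2 is not a zero divisor, the quotient
z is again Frobenius-fixed. Applying this twice shows that traces are integers modulo 4. -/
theorem WittVector.exists_int_add_two_mul {y : WittVector 2 F}
    (hy : WittVector.frobenius y = y) :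
    ∃ (n : ℤ) (z : WittVector 2 F), WittVector.frobenius z = z ∧ y = n + 2 * z := by
  have h0 : y.coeff 0 = 0 ∨ y.coeff 0 = 1 := by
    have h1 := congrArg (fun x => x.coeff 0) hy
    simp only [coeff_frobenius_charP] at h1
    have h2 : y.coeff 0 * (y.coeff 0 - 1) = 0 := by linear_combination h1
    exact (mul_eq_zero.1 h2).imp id sub_eq_zero.1
  obtain ⟨n, hn⟩ : ∃ n : ℤ, y.coeff 0 = n := by
    rcases h0 with h | h
    · exact ⟨0, by simp [h]⟩
    · exact ⟨1, by simp [h]⟩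
  obtain ⟨z, hz⟩ := exists_eq_two_mul (x := y - (n : WittVector 2 F)) (by
    change (constantCoeff : WittVector 2 F →+* F) (y - (n : WittVector 2 F)) = 0
    rw [map_sub, map_intCast, ← hn]
    exact sub_self _)
  refine ⟨n, z, ?_, by rw [← hz]; ring⟩
  have h2 : (2 : WittVector 2 F) ≠ 0 := WittVector.p_nonzero 2 F
  refine mul_left_cancel₀ h2 ?_
  have h3 : (2 : WittVector 2 F) * WittVector.frobenius z = WittVector.frobenius (2 * z) := by
    rw [map_mul, map_ofNat]
  rw [h3, ← hz, map_sub, hy, map_intCast]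

theorem exists_int_galoisTrace {r : ℕ} (hq : Fintype.card F = 2 ^ r) (x : WittVector 2 F) :
    ∃ n : ℤ, galoisTrace r x = n := by
  obtain ⟨n, z, hz, h1⟩ := exists_int_add_two_mul (frobenius_conjugateSum hq x)
  obtain ⟨m, z', -, h2⟩ := exists_int_add_two_mul hz
  refine ⟨n + 2 * m, ?_⟩
  rw [galoisTrace_eq, h1, h2,
    show (n : WittVector 2 F) + 2 * (m + 2 * z') = ((n + 2 * m : ℤ) : WittVector 2 F) + 4 * z' by
      push_cast; ring, map_add, truncate_four_mul, add_zero, map_intCast]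

/-- The value `ω ^ Tr x` for a Witt vector `x`. -/
noncomputable def wittPhase (r : ℕ) (ω : ℂ) (x : WittVector 2 F) : ℂ :=
  ω ^ Function.invFun (Int.cast : ℤ → TruncatedWittVector 2 2 F) (galoisTrace r x)

/-- The integer picked by `Function.invFun` is determined only modulo 4, which is harmless since ω⁴
= 1. -/
theorem wittPhase_eq {r : ℕ} {ω : ℂ} (hω : IsPrimitiveRoot ω 4) {x : WittVector 2 F} {n : ℤ}
    (h : galoisTrace r x = n) : wittPhase r ω x = ω ^ n := by
  have h1 := Function.invFun_eq (f := (Int.cast : ℤ → TruncatedWittVector 2 2 F))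
    ⟨n, h.symm⟩
  rw [wittPhase]
  set k := Function.invFun (Int.cast : ℤ → TruncatedWittVector 2 2 F) (galoisTrace r x)
  have h2 : (4 : ℤ) ∣ k - n := by
    refine WittVector.four_dvd_of_intCast_eq_zero (F := F) ?_
    rw [Int.cast_sub, h1, h, sub_self]
  have h3 : ω ^ (k - n) = 1 := (hω.zpow_eq_one_iff_dvd _).2 h2
  have h0 : ω ≠ 0 := hω.ne_zero (by norm_num)
  rw [zpow_sub₀ h0, div_eq_one_iff_eq (zpow_ne_zero _ h0)] at h3
  exact h3

theorem wittPhase_add {r : ℕ} (hq : Fintype.card F = 2 ^ r) {ω : ℂ} (hω : IsPrimitiveRoot ω 4)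
    (x y : WittVector 2 F) : wittPhase r ω (x + y) = wittPhase r ω x * wittPhase r ω y := by
  obtain ⟨n, hn⟩ := exists_int_galoisTrace hq x
  obtain ⟨m, hm⟩ := exists_int_galoisTrace hq y
  have h : galoisTrace r (x + y) = (n + m : ℤ) := by
    rw [galoisTrace_add, hn, hm, Int.cast_add]
  rw [wittPhase_eq hω h, wittPhase_eq hω hn, wittPhase_eq hω hm,
    zpow_add₀ (hω.ne_zero (by norm_num))]

theorem wittPhase_four_mul {r : ℕ} {ω : ℂ} (hω : IsPrimitiveRoot ω 4) (x : WittVector 2 F) :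
    wittPhase r ω (4 * x) = 1 := by
  have h : galoisTrace r (4 * x) = (0 : ℤ) := by rw [galoisTrace_four_mul, Int.cast_zero]
  rw [wittPhase_eq hω h, zpow_zero]

theorem wittPhase_add_four_mul {r : ℕ} (hq : Fintype.card F = 2 ^ r) {ω : ℂ}
    (hω : IsPrimitiveRoot ω 4) (x y : WittVector 2 F) :
    wittPhase r ω (x + 4 * y) = wittPhase r ω x := by
  rw [wittPhase_add hq hω, wittPhase_four_mul hω, mul_one]

/-- The doubled conjugate sum modulo 4 depends only on its residue, which is the field trace of x,
and ω² = -1. This form of χ makes primitivity and Galois invariance visible. -/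
theorem wittPhase_two_mul_teichmuller [Algebra (ZMod 2) F] {r : ℕ}
    (hq : Fintype.card F = 2 ^ r) {ω : ℂ} (hω : IsPrimitiveRoot ω 4) (x : F) :
    wittPhase r ω (2 * teichmuller 2 x) =
      if Algebra.trace (ZMod 2) F x = 0 then 1 else -1 := by
  set u := conjugateSum r (teichmuller 2 x) with hu
  have hu0 : u.coeff 0 = algebraMap (ZMod 2) F (Algebra.trace (ZMod 2) F x) := by
    rw [FiniteField.algebraMap_trace_eq_sum_pow, finrank_eq_of_card_eq hq, hu, conjugateSum_apply]
    change (constantCoeff : WittVector 2 F →+* F) _ = _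
    rw [map_sum]
    refine Finset.sum_congr rfl fun i _ => ?_
    change ((WittVector.frobenius : WittVector 2 F →+* _)^[i] (teichmuller 2 x)).coeff 0 = _
    rw [iterate_frobenius_coeff, teichmuller_coeff_zero, Nat.card_zmod]
  have htr : galoisTrace r (2 * teichmuller 2 x) = truncate 2 (2 * u) := by
    rw [galoisTrace_eq, conjugateSum_two_mul]
  split_ifs with h
  · rw [h, map_zero] at hu0
    obtain ⟨z, hz⟩ := exists_eq_two_mul hu0
    have h1 : galoisTrace r (2 * teichmuller 2 x) = (0 : ℤ) := by
      rw [htr, hz, ← mul_assoc, show (2 : WittVector 2 F) * 2 = 4 by norm_num,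
        truncate_four_mul, Int.cast_zero]
    rw [wittPhase_eq hω h1, zpow_zero]
  · have h1 : ∀ a : ZMod 2, a ≠ 0 → a = 1 := by decide
    rw [h1 _ h, map_one] at hu0
    obtain ⟨z, hz⟩ := exists_eq_two_mul (x := u - 1) (by
      change (constantCoeff : WittVector 2 F →+* F) (u - 1) = 0
      rw [map_sub, map_one]
      change u.coeff 0 - 1 = 0
      rw [hu0, sub_self])
    have h2 : galoisTrace r (2 * teichmuller 2 x) = (2 : ℤ) := by
      rw [htr, show 2 * u = ((2 : ℤ) : WittVector 2 F) + 4 * z by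
        push_cast; linear_combination 2 * hz, map_add, truncate_four_mul, add_zero, map_intCast]
    rw [wittPhase_eq hω h2]
    have h3 : (ω ^ 2 - 1) * (ω ^ 2 + 1) = 0 := by linear_combination hω.pow_eq_one
    have h4 : ω ^ 2 ≠ 1 := hω.pow_ne_one_of_pos_of_lt (by norm_num) (by norm_num)
    have h5 := (mul_eq_zero.1 h3).resolve_left (sub_ne_zero.2 h4)
    exact_mod_cast eq_neg_of_add_eq_zero_left h5

theorem exists_isFramed_even [DecidableEq F] [Algebra (ZMod 2) F] {r : ℕ}
    (hq : Fintype.card F = 2 ^ r) {ω : ℂ} (hω : IsPrimitiveRoot ω 4) :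
    ∃ χ g, IsFramed χ g (classicalMUB (F := F) 2 r ω) := by
  let χ : AddChar F ℂ :=
    { toFun := fun x => wittPhase r ω (2 * teichmuller 2 x)
      map_zero_eq_one' := by rw [wittPhase_two_mul_teichmuller hq hω, map_zero, if_pos rfl]
      map_add_eq_mul' := fun x y => by
        obtain ⟨z, hz⟩ := exists_teichmuller_add x y
        rw [hz, show 2 * (teichmuller 2 x + teichmuller 2 y + 2 * z) =
          2 * teichmuller 2 x + 2 * teichmuller 2 y + 4 * z by ring,
          wittPhase_add_four_mul hq hω, wittPhase_add hq hω] }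
  have hχ : ∀ x, χ x = if Algebra.trace (ZMod 2) F x = 0 then 1 else -1 :=
    wittPhase_two_mul_teichmuller hq hω
  have hne : ∀ x : WittVector 2 F, wittPhase r ω x ≠ 0 := fun x =>
    zpow_ne_zero _ (hω.ne_zero (by norm_num))
  refine ⟨χ, fun m w => wittPhase r ω
      (teichmuller 2 w * (teichmuller 2 w * teichmuller 2 m)), ?_, fun θ x => ?_,
    fun m w => hne _, fun m w w' => ?_, fun v => rfl, _, inv_sqrt_card_ne_zero (F := F), fun m v w => ?_⟩
  · refine AddChar.IsPrimitive.of_ne_one ?_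
    rw [AddChar.ne_one_iff]
    obtain ⟨b, hb⟩ := Algebra.trace_surjective (ZMod 2) F 1
    refine ⟨b, ?_⟩
    rw [hχ, hb]
    norm_num
  · rw [hχ, hχ, trace_ringAut]
  · obtain ⟨z, hz⟩ := exists_teichmuller_add w w'
    change _ = _ * wittPhase r ω (2 * teichmuller 2 (m * w * w'))
    -- Teichmüller lifts are additive modulo 2, so their squares are additive modulo 4 up to the
    -- cross term 2 a b, which gives the polarization.
    have key : ∀ a b c z : WittVector 2 F, (a + b + 2 * z) * ((a + b + 2 * z) * c) =
        a * (a * c) + b * (b * c) + 2 * (c * a * b) + 4 * ((a + b) * z * c + z * z * c) := by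
      intros; ring
    rw [hz, map_mul, map_mul, key, wittPhase_add_four_mul hq hω, wittPhase_add hq hω,
      wittPhase_add hq hω]
  · simp only [classicalMUB, if_true, evenPhase]
    change _ = _ * (_ * wittPhase r ω (2 * teichmuller 2 (v * w)))
    rw [← wittPhase_add hq hω, mul_comm v w, map_mul]
    rfl

end Even

/-! ### Automorphisms of ℂ³ with the cross product that permute the axes -/

section Cross

open Matrix

/-- Both sides are multiplicative in π, so a check on transpositions suffices. -/
theorem crossProduct_comp_perm (π : Equiv.Perm (Fin 3)) (u v : Fin 3 → ℂ) :
    crossProduct (u ∘ π) (v ∘ π) = ((Equiv.Perm.sign π : ℤ) : ℂ) • (crossProduct u v ∘ π) := by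
  induction π using Equiv.Perm.swap_induction_on generalizing u v with
  | one => simp
  | swap_mul f x y hxy ih =>
    have h : ∀ u v : Fin 3 → ℂ, crossProduct (u ∘ Equiv.swap x y) (v ∘ Equiv.swap x y) =
        -(crossProduct u v ∘ Equiv.swap x y) := by
      intro u v
      fin_cases x <;> fin_cases y <;> first
        | exact absurd rfl hxy
        | (ext i
           fin_cases i <;> simp [cross_apply, Equiv.swap_apply_def])
    have h2 : ∀ u : Fin 3 → ℂ, u ∘ (Equiv.swap x y * f) = (u ∘ Equiv.swap x y) ∘ f := fun _ => rfl
    rw [h2, h2, ih, h, h2, Equiv.Perm.sign_mul, Equiv.Perm.sign_swap hxy]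
    ext i
    simp

variable {𝔤 ι : Type*} [LieRing 𝔤] [LieAlgebra ℂ 𝔤]

/-- The linear automorphisms that preserve the bracket and permute the members of a family of
sets form the subgroup `S`, where the sets are the coordinate axes of a Lie algebra isomorphic
to `ℂ³` with a multiple of the cross product. -/
structure IsAxisGroup (L : (Fin 3 → ℂ) ≃ₗ[ℂ] 𝔤) (κ : ℂ) (S : Subgroup (𝔤 ≃ₗ[ℂ] 𝔤)) : Prop where
  ne_zero : κ ≠ 0
  bracket : ∀ x y, ⁅L x, L y⁆ = κ • L (crossProduct x y)
  mem_iff : ∀ φ, φ ∈ S ↔ (∀ x y, φ ⁅x, y⁆ = ⁅φ x, φ y⁆) ∧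
    ∀ i : Fin 3, ∃ j, φ '' {x | ∃ t : ℂ, x = t • L (Pi.single i 1)} =
      {x | ∃ t : ℂ, x = t • L (Pi.single j 1)}

variable {L : (Fin 3 → ℂ) ≃ₗ[ℂ] 𝔤} {κ : ℂ} {S : Subgroup (𝔤 ≃ₗ[ℂ] 𝔤)}

/-- `φ` permutes the coordinate axes as `π`. -/
def PermutesAxes (L : (Fin 3 → ℂ) ≃ₗ[ℂ] 𝔤) (φ : 𝔤 ≃ₗ[ℂ] 𝔤) (π : Equiv.Perm (Fin 3)) : Prop :=
  ∃ c : Fin 3 → ℂ, (∀ i, c i ≠ 0) ∧ ∀ i, φ (L (Pi.single i 1)) = c i • L (Pi.single (π i) 1)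

theorem eq_of_smul_axis {a b : ℂ} (ha : a ≠ 0) {i j : Fin 3}
    (h : a • L (Pi.single i 1) = b • L (Pi.single j 1)) : i = j ∧ a = b := by
  rw [← map_smul, ← map_smul, L.injective.eq_iff] at h
  have h1 := congrFun h i
  by_cases hij : i = j
  · subst hij
    exact ⟨rfl, by simpa using h1⟩
  · simp [hij, ha] at h1

theorem PermutesAxes.mul {φ φ' : 𝔤 ≃ₗ[ℂ] 𝔤} {π π' : Equiv.Perm (Fin 3)}
    (h : PermutesAxes L φ π) (h' : PermutesAxes L φ' π') : PermutesAxes L (φ * φ') (π * π') := by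
  obtain ⟨c, hc, hφ⟩ := h
  obtain ⟨c', hc', hφ'⟩ := h'
  refine ⟨fun i => c' i * c (π' i), fun i => mul_ne_zero (hc' i) (hc _), fun i => ?_⟩
  rw [LinearEquiv.mul_apply, hφ', map_smul, hφ, smul_smul]
  rfl

theorem PermutesAxes.unique {φ : 𝔤 ≃ₗ[ℂ] 𝔤} {π π' : Equiv.Perm (Fin 3)}
    (h : PermutesAxes L φ π) (h' : PermutesAxes L φ π') : π = π' := by
  obtain ⟨c, hc, hφ⟩ := h
  obtain ⟨c', hc', hφ'⟩ := h'
  ext1 i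
  exact (eq_of_smul_axis (hc i) ((hφ i).symm.trans (hφ' i))).1

theorem IsAxisGroup.exists_permutesAxes (h : IsAxisGroup L κ S) (φ : S) :
    ∃ π, PermutesAxes L φ.1 π := by
  have h1 : ∀ i, ∃ j, ∃ t : ℂ, φ.1 (L (Pi.single i 1)) = t • L (Pi.single j 1) := by
    intro i
    obtain ⟨j, hj⟩ := ((h.mem_iff φ.1).1 φ.2).2 i
    exact ⟨j, (Set.ext_iff.1 hj _).1 ⟨_, ⟨1, (one_smul _ _).symm⟩, rfl⟩⟩
  choose π c hφ using h1
  have hc : ∀ i, c i ≠ 0 := by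
    intro i hi
    have h2 := hφ i
    rw [hi, zero_smul, LinearEquiv.map_eq_zero_iff, LinearEquiv.map_eq_zero_iff] at h2
    simp at h2
  have hinj : Function.Injective π := by
    intro i j hij
    have h2 : c j • L (Pi.single i 1) = c i • L (Pi.single j 1) := by
      apply φ.1.injective
      rw [map_smul, map_smul, hφ, hφ, hij, smul_smul, smul_smul, mul_comm]
    exact (eq_of_smul_axis (hc j) h2).1
  exact ⟨Equiv.ofBijective π (Finite.injective_iff_bijective.1 hinj), c, hc, hφ⟩

/-- The permutation of the coordinate axes. -/
noncomputable def IsAxisGroup.permHom (h : IsAxisGroup L κ S) : S →* Equiv.Perm (Fin 3) :=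
  MonoidHom.mk' (fun φ => (h.exists_permutesAxes φ).choose) fun φ φ' =>
    (h.exists_permutesAxes (φ * φ')).choose_spec.unique
      ((h.exists_permutesAxes φ).choose_spec.mul (h.exists_permutesAxes φ').choose_spec)

theorem IsAxisGroup.permHom_eq (h : IsAxisGroup L κ S) {φ : S} {π : Equiv.Perm (Fin 3)}
    (hφ : PermutesAxes L φ.1 π) : h.permHom φ = π :=
  (h.exists_permutesAxes φ).choose_spec.unique hφ

/-- The linear automorphism that is monomial with respect to the coordinates. -/
noncomputable def axisMonomial (L : (Fin 3 → ℂ) ≃ₗ[ℂ] 𝔤) (π : Equiv.Perm (Fin 3))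
    (d : Fin 3 → ℂ) (hd : ∀ i, d i ≠ 0) : 𝔤 ≃ₗ[ℂ] 𝔤 :=
  (L.symm.trans (monomialEquiv π⁻¹ d hd)).trans L

theorem axisMonomial_apply (π : Equiv.Perm (Fin 3)) (d : Fin 3 → ℂ) (hd : ∀ i, d i ≠ 0)
    (i : Fin 3) :
    axisMonomial L π d hd (L (Pi.single i 1)) = d (π i) • L (Pi.single (π i) 1) := by
  rw [axisMonomial, LinearEquiv.trans_apply, LinearEquiv.trans_apply, L.symm_apply_apply,
    ← map_smul]
  congr 1
  ext j
  by_cases hj : j = π i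
  · subst hj
    simp
  · have : π.symm j ≠ i := fun h => hj (by rw [← h, π.apply_symm_apply])
    simp [hj, this]

theorem permutesAxes_axisMonomial (π : Equiv.Perm (Fin 3)) (d : Fin 3 → ℂ) (hd : ∀ i, d i ≠ 0) :
    PermutesAxes L (axisMonomial L π d hd) π :=
  ⟨fun i => d (π i), fun _ => hd _, axisMonomial_apply π d hd⟩

theorem IsAxisGroup.axisMonomial_mem (h : IsAxisGroup L κ S) (π : Equiv.Perm (Fin 3))
    (d : Fin 3 → ℂ) (hd : ∀ i, d i ≠ 0)
    (hcross : ∀ x y, monomialEquiv π⁻¹ d hd (crossProduct x y) =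
      crossProduct (monomialEquiv π⁻¹ d hd x) (monomialEquiv π⁻¹ d hd y)) :
    axisMonomial L π d hd ∈ S := by
  rw [h.mem_iff]
  refine ⟨fun x y => ?_, fun i => ⟨π i, ?_⟩⟩
  · obtain ⟨x, rfl⟩ := L.surjective x
    obtain ⟨y, rfl⟩ := L.surjective y
    rw [h.bracket, map_smul]
    simp only [axisMonomial, LinearEquiv.trans_apply, L.symm_apply_apply]
    rw [h.bracket, hcross]
  · ext x
    constructor
    · rintro ⟨_, ⟨t, rfl⟩, rfl⟩
      exact ⟨t * d (π i), by rw [map_smul, axisMonomial_apply, smul_smul]⟩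
    · rintro ⟨t, rfl⟩
      refine ⟨(t / d (π i)) • L (Pi.single i 1), ⟨_, rfl⟩, ?_⟩
      rw [map_smul, axisMonomial_apply, smul_smul, div_mul_cancel₀ _ (hd _)]

/-- A coordinate permutation distorts the cross product by its sign; scaling the permutation by that
same sign, whose square is 1, repairs this. -/
theorem IsAxisGroup.permHom_surjective (h : IsAxisGroup L κ S) :
    Function.Surjective h.permHom := by
  intro π
  have hs : (((Equiv.Perm.sign π : ℤ) : ℂ)) * ((Equiv.Perm.sign π : ℤ) : ℂ) = 1 := by
    rw [← Int.cast_mul, ← Units.val_mul, Int.units_mul_self]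
    simp
  have hd : ∀ i : Fin 3, (fun _ : Fin 3 => ((Equiv.Perm.sign π : ℤ) : ℂ)) i ≠ 0 :=
    fun _ h0 => by simp only at h0; rw [h0, zero_mul] at hs; exact zero_ne_one hs
  refine ⟨⟨axisMonomial L π _ hd, h.axisMonomial_mem π _ hd fun x y => ?_⟩,
    h.permHom_eq (permutesAxes_axisMonomial π _ hd)⟩
  have h1 : ∀ v : Fin 3 → ℂ, monomialEquiv π⁻¹ _ hd v =
      ((Equiv.Perm.sign π : ℤ) : ℂ) • (v ∘ (π⁻¹ : Equiv.Perm (Fin 3))) := fun v => rfl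
  rw [h1, h1, h1, map_smul, map_smul, LinearMap.smul_apply, crossProduct_comp_perm, Equiv.Perm.sign_inv, smul_smul, hs,
    one_smul]

variable {F : Type*} [Field F] {χ : AddChar F ℂ}

/-- The signs `(χ a, χ b, χ (a + b))`. -/
def axisSigns (χ : AddChar F ℂ) (x : F × F) : Fin 3 → ℂ := ![χ x.1, χ x.2, χ (x.1 + x.2)]

theorem axisSigns_ne_zero (χ : AddChar F ℂ) (x : F × F) (i : Fin 3) : axisSigns χ x i ≠ 0 := by
  fin_cases i <;> exact AddChar.apply_ne_zero _ _

theorem axisSigns_add (χ : AddChar F ℂ) (x y : F × F) (i : Fin 3) :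
    axisSigns χ (x + y) i = axisSigns χ x i * axisSigns χ y i := by
  fin_cases i
  · exact AddChar.map_add_eq_mul _ _ _
  · exact AddChar.map_add_eq_mul _ _ _
  · change χ (x.1 + y.1 + (x.2 + y.2)) = _
    rw [add_add_add_comm, AddChar.map_add_eq_mul]
    rfl

theorem ext_axes {φ φ' : 𝔤 ≃ₗ[ℂ] 𝔤}
    (h : ∀ i, φ (L (Pi.single i 1)) = φ' (L (Pi.single i 1))) : φ = φ' := by
  refine LinearEquiv.toLinearMap_injective ?_
  refine ((Pi.basisFun ℂ (Fin 3)).map L).ext fun i => ?_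
  simpa using h i

/-- The three signs have product 1, so each is the product of the other two, which is compatibility
with the cross product. -/
theorem IsAxisGroup.signs_mem (h : IsAxisGroup L κ S) (hsq : ∀ a, χ a * χ a = 1) (x : F × F) :
    axisMonomial L 1 (axisSigns χ x) (axisSigns_ne_zero χ x) ∈ S := by
  refine h.axisMonomial_mem _ _ _ fun u v => ?_
  ext i
  have h1 := hsq x.1
  have h2 := hsq x.2
  fin_cases i <;> simp [cross_apply, axisSigns, AddChar.map_add_eq_mul]
  · linear_combination -(χ x.1) * (u 1 * v 2 - u 2 * v 1) * h2
  · linear_combination -(χ x.2) * (u 2 * v 0 - u 0 * v 2) * h1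
  · ring

/-- The group of sign changes of the coordinates. -/
noncomputable def IsAxisGroup.signHom (h : IsAxisGroup L κ S) (hsq : ∀ a, χ a * χ a = 1) :
    Multiplicative (F × F) →* S :=
  MonoidHom.mk' (fun x => ⟨_, h.signs_mem hsq x.toAdd⟩) fun x y => by
    refine Subtype.ext (ext_axes (L := L) fun i => ?_)
    change _ = axisMonomial L 1 _ _ (axisMonomial L 1 _ _ _)
    rw [axisMonomial_apply, axisMonomial_apply, map_smul, Equiv.Perm.one_apply,
      axisMonomial_apply, smul_smul, Equiv.Perm.one_apply, toAdd_mul, axisSigns_add, mul_comm]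

/-- The automorphism group of the coordinate axes of `ℂ³` with the cross product, as an extension
of the symmetric group by the sign changes. -/
noncomputable def IsAxisGroup.extension (h : IsAxisGroup L κ S) (hsq : ∀ a, χ a * χ a = 1)
    (hinj : ∀ a, χ a = 1 → a = 0) (hsurj : ∃ a, χ a = -1) :
    GroupExtension (Multiplicative (F × F)) S (Equiv.Perm (Fin 3)) where
  inl := h.signHom hsq
  rightHom := h.permHom
  inl_injective := by
    rw [injective_iff_map_eq_one]
    intro x hx
    have h1 : ∀ i, axisSigns χ x.toAdd i = 1 := by
      intro i
      have h2 := axisMonomial_apply (L := L) 1 _ (axisSigns_ne_zero χ x.toAdd) i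
      rw [show axisMonomial L 1 _ (axisSigns_ne_zero χ x.toAdd) = 1 from congrArg Subtype.val hx,
        Equiv.Perm.one_apply] at h2
      exact (eq_of_smul_axis one_ne_zero ((one_smul ℂ _).trans h2)).2.symm
    exact Prod.ext (hinj _ (h1 0)) (hinj _ (h1 1))
  range_inl_eq_ker_rightHom := by
    ext φ
    rw [MonoidHom.mem_ker]
    constructor
    · rintro ⟨x, rfl⟩
      exact h.permHom_eq (permutesAxes_axisMonomial 1 _ _)
    · intro hφ
      obtain ⟨c, hc, hφc⟩ := (h.exists_permutesAxes φ).choose_spec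
      rw [show (h.exists_permutesAxes φ).choose = 1 from hφ] at hφc
      simp only [Equiv.Perm.one_apply] at hφc
      -- The three cyclic relations between basis vectors make each factor the product of the other
      -- two; hence all are signs with product 1, and the first two determine (a, b).
      have hrel : ∀ i j k : Fin 3, crossProduct (Pi.single i (1 : ℂ)) (Pi.single j 1) =
          Pi.single k 1 → c k = c i * c j := by
        intro i j k hijk
        have h1 := ((h.mem_iff φ.1).1 φ.2).1 (L (Pi.single i 1)) (L (Pi.single j 1))
        rw [h.bracket, hijk, map_smul, hφc, hφc, hφc, smul_lie, lie_smul, h.bracket, hijk,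
          smul_smul, smul_smul, smul_smul] at h1
        have h2 := (eq_of_smul_axis (mul_ne_zero h.ne_zero (hc k)) h1).2
        refine mul_left_cancel₀ h.ne_zero ?_
        rw [h2]
        ring
      have r2 : c 2 = c 0 * c 1 := hrel 0 1 2 (by
        ext i; fin_cases i <;> simp [cross_apply])
      have r0 : c 0 = c 1 * c 2 := hrel 1 2 0 (by
        ext i; fin_cases i <;> simp [cross_apply])
      have r1 : c 1 = c 2 * c 0 := hrel 2 0 1 (by
        ext i; fin_cases i <;> simp [cross_apply])
      have hsign : ∀ z : ℂ, z * z = 1 → ∃ a, χ a = z := by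
        intro z hz
        rcases mul_self_eq_one_iff.1 hz with rfl | rfl
        · exact ⟨0, χ.map_zero_eq_one⟩
        · exact hsurj
      obtain ⟨a, ha⟩ := hsign (c 0) (mul_left_cancel₀ (hc 1) (by
        linear_combination -r1 - c 0 * r2))
      obtain ⟨b, hb⟩ := hsign (c 1) (mul_left_cancel₀ (hc 0) (by
        linear_combination -r0 - c 1 * r2))
      refine ⟨Multiplicative.ofAdd (a, b), Subtype.ext (ext_axes (L := L) fun i => ?_)⟩
      change axisMonomial L 1 _ (axisSigns_ne_zero χ (a, b)) _ = _
      rw [axisMonomial_apply, hφc, Equiv.Perm.one_apply]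
      congr 1
      fin_cases i
      · exact ha
      · exact hb
      · change χ (a + b) = c 2
        rw [r2, AddChar.map_add_eq_mul, ha, hb]
  rightHom_surjective := h.permHom_surjective

end Cross

/-! ### The isomorphism of S₃ with SL₂(2) -/

section SymmetricGroup

/-- The nonzero vectors of `(ℤ/2)²`. -/
def nonzeroVec : Fin 3 → Fin 2 → ZMod 2 := ![![0, 1], ![1, 0], ![1, 1]]

/-- The matrix that permutes the nonzero vectors of `(ℤ/2)²` in a given way. -/
def permVecMatrix (π : Equiv.Perm (Fin 3)) : Matrix (Fin 2) (Fin 2) (ZMod 2) :=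
  !![nonzeroVec (π 1) 0, nonzeroVec (π 0) 0; nonzeroVec (π 1) 1, nonzeroVec (π 0) 1]

theorem permVecMatrix_mul :
    ∀ π σ, permVecMatrix (π * σ) = permVecMatrix π * permVecMatrix σ := by decide

/-- The symmetric group of degree three as the group `SL₂(2)`. -/
def permToSL : Equiv.Perm (Fin 3) →* Matrix.SpecialLinearGroup (Fin 2) (ZMod 2) :=
  MonoidHom.mk' (fun π => ⟨permVecMatrix π, by
    rw [permVecMatrix, Matrix.det_fin_two_of]; revert π; decide⟩)
    fun π σ => Subtype.ext (permVecMatrix_mul π σ)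

theorem permToSL_bijective : Function.Bijective permToSL := by
  constructor
  · rw [injective_iff_map_eq_one]
    decide
  · decide

end SymmetricGroup

/-! ### The orthogonal decomposition of sl₂ for q = 2 -/

section SpecialLinearTwo

variable {F : Type*} [Field F] [Fintype F] [DecidableEq F]

theorem eq_zero_or_one_of_card_eq_two (hF : Fintype.card F = 2) (a : F) : a = 0 ∨ a = 1 := by
  have h : ({0, 1} : Finset F) = Finset.univ := by
    rw [← Finset.card_eq_iff_eq_univ, hF, Finset.card_pair zero_ne_one]
  have ha := Finset.mem_univ a
  rw [← h] at ha
  simpa using ha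

theorem sum_of_card_eq_two (hF : Fintype.card F = 2) (f : F → ℂ) : ∑ a, f a = f 0 + f 1 := by
  have h : ({0, 1} : Finset F) = Finset.univ := by
    rw [← Finset.card_eq_iff_eq_univ, hF, Finset.card_pair zero_ne_one]
  rw [← h, Finset.sum_pair zero_ne_one]

/-- The matrix with the given coordinates with respect to (multiples of) the Pauli matrices. -/
noncomputable def pauliMatrix (x : Fin 3 → ℂ) : Matrix F F ℂ := fun i j =>
  if i = 0 then (if j = 0 then x 0 else x 1 + Complex.I * x 2)
  else (if j = 0 then x 1 - Complex.I * x 2 else -x 0)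

theorem pauliMatrix_mem (hF : Fintype.card F = 2) (x : Fin 3 → ℂ) :
    pauliMatrix (F := F) x ∈ LieAlgebra.SpecialLinear.sl F ℂ := by
  change Matrix.trace _ = 0
  rw [Matrix.trace, sum_of_card_eq_two hF]
  simp [pauliMatrix]

/-- The coordinates of `sl₂` with respect to (multiples of) the Pauli matrices. -/
noncomputable def pauliEquiv (hF : Fintype.card F = 2) :
    (Fin 3 → ℂ) ≃ₗ[ℂ] LieAlgebra.SpecialLinear.sl F ℂ where
  toFun x := ⟨pauliMatrix x, pauliMatrix_mem hF x⟩
  invFun A := ![A.1 0 0, (A.1 0 1 + A.1 1 0) / 2, (A.1 0 1 - A.1 1 0) / (2 * Complex.I)]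
  map_add' x y := by
    ext i j
    change pauliMatrix (x + y) i j = pauliMatrix x i j + pauliMatrix y i j
    simp only [pauliMatrix, Pi.add_apply]
    split_ifs <;> ring
  map_smul' c x := by
    ext i j
    change pauliMatrix (c • x) i j = c * pauliMatrix x i j
    simp only [pauliMatrix, Pi.smul_apply, smul_eq_mul]
    split_ifs <;> ring
  left_inv x := by
    ext k
    fin_cases k
    · simp [pauliMatrix]
    · simp [pauliMatrix]
    · simp only [pauliMatrix]
      have := Complex.I_ne_zero
      simp
      field_simp
      ring
  right_inv A := by
    have htr : A.1 0 0 + A.1 1 1 = 0 := by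
      have h : Matrix.trace A.1 = 0 := A.2
      rwa [Matrix.trace, sum_of_card_eq_two hF] at h
    have := Complex.I_ne_zero
    ext i j
    rcases eq_zero_or_one_of_card_eq_two hF i with rfl | rfl <;>
      rcases eq_zero_or_one_of_card_eq_two hF j with rfl | rfl <;>
      simp [pauliMatrix]
    · field_simp
      ring
    · field_simp
      ring
    · linear_combination -htr

theorem pauliEquiv_coe (hF : Fintype.card F = 2) (x : Fin 3 → ℂ) :
    (pauliEquiv hF x).1 = (pauliMatrix x : Matrix F F ℂ) := rfl

theorem pauliEquiv_bracket (hF : Fintype.card F = 2) (x y : Fin 3 → ℂ) :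
    ⁅pauliEquiv hF x, pauliEquiv hF y⁆ =
      (-2 * Complex.I) • pauliEquiv hF (crossProduct x y) := by
  have hI := Complex.I_mul_I
  apply Subtype.ext
  rw [LieAlgebra.SpecialLinear.sl_bracket, ← map_smul, pauliEquiv_coe, pauliEquiv_coe,
    pauliEquiv_coe]
  ext i j
  rw [Matrix.sub_apply, Matrix.mul_apply, Matrix.mul_apply, sum_of_card_eq_two hF,
    sum_of_card_eq_two hF]
  rcases eq_zero_or_one_of_card_eq_two hF i with rfl | rfl <;>
    rcases eq_zero_or_one_of_card_eq_two hF j with rfl | rfl <;>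
    simp [pauliMatrix, cross_apply]
  · ring
  · linear_combination (2 * (x 0 * y 1 - x 1 * y 0)) * hI
  · linear_combination (2 * (x 1 * y 0 - x 0 * y 1)) * hI
  · ring

variable {χ : AddChar F ℂ} {g : F → F → ℂ} {B : Option F → F → F → ℂ}

theorem IsFramed.apply_one_of_card_eq_two (h : IsFramed χ g B) (hF : Fintype.card F = 2) :
    χ 1 = -1 := by
  have h2 : (1 : F) + 1 = 0 := by
    rcases eq_zero_or_one_of_card_eq_two hF (1 + 1) with h0 | h0
    · exact h0
    · simp at h0
  have hsq : χ 1 * χ 1 = 1 := by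
    rw [← AddChar.map_add_eq_mul, h2, AddChar.map_zero_eq_one]
  refine (mul_self_eq_one_iff.1 hsq).resolve_left fun h1 => ?_
  refine one_ne_zero (h.primitive.eq_of_forall (x := (1 : F)) (y := 0) fun b => ?_)
  rcases eq_zero_or_one_of_card_eq_two hF b with rfl | rfl <;> simp [h1]

theorem IsFramed.sq_of_card_eq_two (h : IsFramed χ g B) (hF : Fintype.card F = 2) (m : F) :
    g m 1 * g m 1 * χ m = 1 := by
  have h2 : (1 : F) + 1 = 0 := by
    rcases eq_zero_or_one_of_card_eq_two hF (1 + 1) with h0 | h0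
    · exact h0
    · simp at h0
  have := h.add m 1 1
  rw [h2, h.zero_right, mul_one, mul_one] at this
  exact this.symm

/-- The coordinate axis that belongs to a basis of the family. -/
def axisOf (i : Option F) : Fin 3 := i.elim 0 fun a => if a = 0 then 1 else 2

theorem axisOf_surjective : Function.Surjective (axisOf (F := F)) := by
  intro k
  fin_cases k
  · exact ⟨none, rfl⟩
  · exact ⟨some 0, by simp [axisOf]⟩
  · exact ⟨some 1, by simp [axisOf]⟩

theorem mulVec_pauliMatrix (hF : Fintype.card F = 2) (x : Fin 3 → ℂ) (v : F → ℂ) :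
    (pauliMatrix x : Matrix F F ℂ).mulVec v = fun i => if i = 0 then
      x 0 * v 0 + (x 1 + Complex.I * x 2) * v 1 else
      (x 1 - Complex.I * x 2) * v 0 - x 0 * v 1 := by
  ext i
  rw [Matrix.mulVec, dotProduct, sum_of_card_eq_two hF]
  rcases eq_zero_or_one_of_card_eq_two hF i with rfl | rfl <;> simp [pauliMatrix]
  ring

theorem exists_mulVec_pauliMatrix (hF : Fintype.card F = 2) (x : Fin 3 → ℂ) (v : F → ℂ) :
    (∃ c : ℂ, (pauliMatrix x : Matrix F F ℂ).mulVec v = c • v) ↔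
      ∃ c : ℂ, x 0 * v 0 + (x 1 + Complex.I * x 2) * v 1 = c * v 0 ∧
        (x 1 - Complex.I * x 2) * v 0 - x 0 * v 1 = c * v 1 := by
  refine exists_congr fun c => ?_
  rw [mulVec_pauliMatrix hF]
  constructor
  · intro h
    exact ⟨by simpa using congrFun h 0, by simpa using congrFun h 1⟩
  · rintro ⟨h0, h1⟩
    ext i
    rcases eq_zero_or_one_of_card_eq_two hF i with rfl | rfl
    · simpa using h0
    · simpa using h1

/-- The two basis vectors are proportional to (1, s) and (1, -s) with s² = χ m. Being an eigenvector
gives one linear equation for each sign; their difference yields x 0 = 0, and the rest no longer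
depends on s. -/
theorem IsFramed.mem_cartanOf_some (h : IsFramed χ g B) (hF : Fintype.card F = 2)
    (x : Fin 3 → ℂ) (m : F) : pauliEquiv hF x ∈ cartanOf (B (some m)) ↔
      x 0 = 0 ∧ (x 1 - Complex.I * x 2) = (x 1 + Complex.I * x 2) * χ m := by
  obtain ⟨c₀, hc₀, hB⟩ := h.basis_some
  have hχ := h.apply_one_of_card_eq_two hF
  have hsq := h.sq_of_card_eq_two hF m
  have hχm : χ m * χ m = 1 := by
    rcases eq_zero_or_one_of_card_eq_two hF m with rfl | rfl
    · simp
    · rw [hχ]; norm_num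
  have hs : g m 1 * g m 1 = χ m := by linear_combination χ m * hsq - g m 1 * g m 1 * hχm
  have hg := h.ne_zero m 1
  have key : ∀ s : ℂ, s * s = χ m →
      ((∃ c : ℂ, x 0 * (c₀ * 1) + (x 1 + Complex.I * x 2) * (c₀ * s) = c * (c₀ * 1) ∧
        (x 1 - Complex.I * x 2) * (c₀ * 1) - x 0 * (c₀ * s) = c * (c₀ * s)) ↔
      (x 1 - Complex.I * x 2) = (x 1 + Complex.I * x 2) * χ m + 2 * s * x 0) := by
    intro s hs
    constructor
    · rintro ⟨c, h1, h2⟩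
      refine mul_left_cancel₀ hc₀ ?_
      linear_combination h2 - s * h1 + c₀ * (x 1 + Complex.I * x 2) * hs
    · intro h1
      refine ⟨x 0 + (x 1 + Complex.I * x 2) * s, by ring, ?_⟩
      linear_combination c₀ * h1 - c₀ * (x 1 + Complex.I * x 2) * hs
  have hv : ∀ v, (∃ c : ℂ, (pauliMatrix x : Matrix F F ℂ).mulVec (B (some m) v) =
      c • B (some m) v) ↔ (x 1 - Complex.I * x 2) = (x 1 + Complex.I * x 2) * χ m +
        2 * (g m 1 * χ v) * x 0 := by
    intro v
    rw [exists_mulVec_pauliMatrix hF, hB, hB, h.zero_right, mul_zero, AddChar.map_zero_eq_one,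
      mul_one, mul_one v]
    refine key _ ?_
    have : χ v * χ v = 1 := by
      rcases eq_zero_or_one_of_card_eq_two hF v with rfl | rfl
      · simp
      · rw [hχ]; norm_num
    linear_combination hs + g m 1 * g m 1 * this
  change (∀ v, ∃ c : ℂ, (pauliMatrix x : Matrix F F ℂ).mulVec (B (some m) v) =
      c • B (some m) v) ↔ _
  simp only [hv]
  constructor
  · intro H
    have h0 := H 0
    have h1 := H 1
    rw [AddChar.map_zero_eq_one] at h0
    rw [hχ] at h1
    have hx : g m 1 * x 0 = 0 := by linear_combination (h1 - h0) / 4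
    have hx0 := (mul_eq_zero.1 hx).resolve_left hg
    exact ⟨hx0, by rw [h0, hx0]; ring⟩
  · rintro ⟨h0, h1⟩ v
    rw [h0, h1]; ring

theorem IsFramed.mem_cartanOf_none (h : IsFramed χ g B) (hF : Fintype.card F = 2)
    (x : Fin 3 → ℂ) : pauliEquiv hF x ∈ cartanOf (B none) ↔ x 1 = 0 ∧ x 2 = 0 := by
  change (∀ v, ∃ c : ℂ, (pauliMatrix x : Matrix F F ℂ).mulVec (B none v) = c • B none v) ↔ _
  simp only [exists_mulVec_pauliMatrix hF, h.basis_none]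
  have hI := Complex.I_ne_zero
  constructor
  · intro H
    obtain ⟨c, -, h0⟩ := H 0
    obtain ⟨d, h1, -⟩ := H 1
    simp at h0 h1
    have h2 : x 1 = 0 := by linear_combination (h0 + h1) / 2
    refine ⟨h2, ?_⟩
    rw [h2, zero_add] at h1
    exact (mul_eq_zero.1 h1).resolve_left hI
  · rintro ⟨h1, h2⟩ v
    rcases eq_zero_or_one_of_card_eq_two hF v with rfl | rfl
    · exact ⟨x 0, by simp [h1, h2]⟩
    · exact ⟨-x 0, by simp [h1, h2]⟩

theorem IsFramed.cartanOf_eq (h : IsFramed χ g B) (hF : Fintype.card F = 2) (i : Option F) :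
    cartanOf (B i) = {A | ∃ t : ℂ, A = t • pauliEquiv hF (Pi.single (axisOf i) 1)} := by
  have hI := Complex.I_ne_zero
  have key : ∀ (k : Fin 3) (x : Fin 3 → ℂ), (∀ j, j ≠ k → x j = 0) ↔
      ∃ t : ℂ, pauliEquiv hF x = t • pauliEquiv hF (Pi.single k 1) := by
    intro k x
    constructor
    · intro H
      refine ⟨x k, ?_⟩
      rw [← map_smul]
      congr 1
      ext j
      by_cases hj : j = k
      · subst hj; simp
      · simp [hj, H j hj]
    · rintro ⟨t, ht⟩ j hj
      rw [← map_smul, (pauliEquiv hF).injective.eq_iff] at ht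
      rw [ht]
      simp [hj]
  ext A
  obtain ⟨x, rfl⟩ := (pauliEquiv hF).surjective A
  rw [Set.mem_ofPred_eq, ← key, Fin.forall_fin_succ, Fin.forall_fin_two]
  cases i with
  | none =>
    rw [h.mem_cartanOf_none]
    simp [axisOf]
  | some m =>
    rw [h.mem_cartanOf_some]
    rcases eq_zero_or_one_of_card_eq_two hF m with rfl | rfl
    · have h1 : x 1 - Complex.I * x 2 = x 1 + Complex.I * x 2 ↔ x 2 = 0 := by
        constructor
        · intro H
          refine (mul_eq_zero.1 (?_ : Complex.I * x 2 = 0)).resolve_left hI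
          linear_combination -H / 2
        · intro H; rw [H]; ring
      simp [axisOf, h1]
    · rw [h.apply_one_of_card_eq_two hF]
      have h1 : x 1 - Complex.I * x 2 = (x 1 + Complex.I * x 2) * -1 ↔ x 1 = 0 := by
        constructor
        · intro H
          linear_combination H / 2
        · intro H; rw [H]; ring
      rw [h1]
      simp [axisOf]

theorem IsFramed.isAxisGroup_odAut (h : IsFramed χ g B) (hF : Fintype.card F = 2) :
    IsAxisGroup (pauliEquiv hF) (-2 * Complex.I) (odAut B) where
  ne_zero := mul_ne_zero (by norm_num) Complex.I_ne_zero
  bracket := pauliEquiv_bracket hF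
  mem_iff φ := by
    change ((∀ x y, φ ⁅x, y⁆ = ⁅φ x, φ y⁆) ∧
      ∀ i, ∃ j, φ '' cartanOf (B i) = cartanOf (B j)) ↔ _
    simp only [h.cartanOf_eq hF]
    refine and_congr_right fun _ => ⟨fun H k => ?_, fun H i => ?_⟩
    · obtain ⟨i, rfl⟩ := axisOf_surjective (F := F) k
      obtain ⟨j, hj⟩ := H i
      exact ⟨_, hj⟩
    · obtain ⟨k, hk⟩ := H (axisOf i)
      obtain ⟨j, rfl⟩ := axisOf_surjective (F := F) k
      exact ⟨j, hk⟩

theorem nonempty_perm_mulEquiv_sl (hF : Fintype.card F = 2) :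
    Nonempty (Equiv.Perm (Fin 3) ≃* Matrix.SpecialLinearGroup (Fin 2) F) :=
  ⟨(MulEquiv.ofBijective permToSL permToSL_bijective).trans
    (slCongr (ZMod.ringEquivOfPrime F Nat.prime_two hF))⟩

/-- A group extension with the quotient replaced by an isomorphic group. -/
def GroupExtension.congrRight {N G Q Q' : Type*} [Group N] [Group G] [Group Q] [Group Q']
    (E : GroupExtension N G Q) (e : Q ≃* Q') : GroupExtension N G Q' where
  inl := E.inl
  rightHom := e.toMonoidHom.comp E.rightHom
  inl_injective := E.inl_injective
  range_inl_eq_ker_rightHom := by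
    rw [E.range_inl_eq_ker_rightHom]
    ext x
    simp [MonoidHom.mem_ker]
  rightHom_surjective := e.surjective.comp E.rightHom_surjective

/-- The extension of the trivial group by a group. -/
def GroupExtension.ofSubsingleton (G Q : Type*) [Group G] [Group Q] [Subsingleton Q] :
    GroupExtension G G Q where
  inl := MonoidHom.id G
  rightHom := 1
  inl_injective := Function.injective_id
  range_inl_eq_ker_rightHom := by
    ext x
    simp
  rightHom_surjective := fun _ => ⟨1, Subsingleton.elim _ _⟩

/-- For q = 2 the character χ identifies F with the group of signs, and S₃ is replaced by SL₂(F). -/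
theorem IsFramed.nonempty_odAut_extension (h : IsFramed χ g B) (hF : Fintype.card F = 2) :
    Nonempty (GroupExtension (Multiplicative (F × F)) (odAut B)
      (Matrix.SpecialLinearGroup (Fin 2) F)) := by
  obtain ⟨e⟩ := nonempty_perm_mulEquiv_sl hF
  have hχ := h.apply_one_of_card_eq_two hF
  refine ⟨((h.isAxisGroup_odAut hF).extension (χ := χ) (fun a => ?_) (fun a ha => ?_)
    ⟨1, hχ⟩).congrRight e⟩
  · rcases eq_zero_or_one_of_card_eq_two hF a with rfl | rfl
    · simp
    · rw [hχ]; norm_num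
  · rcases eq_zero_or_one_of_card_eq_two hF a with rfl | rfl
    · rfl
    · rw [hχ] at ha
      norm_num at ha

end SpecialLinearTwo

/-! ### The classical bases and the final statement -/

theorem exists_isFramed_classicalMUB {F : Type*} [Field F] [Fintype F] [DecidableEq F]
    (p r : ℕ) [Fact p.Prime] [Algebra (ZMod p) F] (hq : Fintype.card F = p ^ r)
    (ω : ℂ) (hω : IsPrimitiveRoot ω (if p = 2 then 4 else p)) :
    ∃ χ g, IsFramed χ g (classicalMUB (F := F) p r ω) := by
  by_cases hp : p = 2
  · subst hp
    have : CharP F 2 := charP_of_injective_algebraMap' (ZMod 2) 2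
    exact exists_isFramed_even hq (by simpa using hω)
  · exact exists_isFramed_odd hp (by simpa [hp] using hω)

theorem mainTheorem11 {F : Type u} [Field F] [Fintype F] [DecidableEq F]
    (p r : ℕ) [Fact p.Prime] [Algebra (ZMod p) F] (hq : Fintype.card F = p ^ r)
    (ω : ℂ) (hω : IsPrimitiveRoot ω (if p = 2 then 4 else p)) :
    -- `Aut(B)` is `F².(SL₂(q).ℤ_r).ℤ₂`
    (∃ (H M : Type u) (_ : Group H) (_ : Group M)
      (E₁ : GroupExtension (Matrix.SpecialLinearGroup (Fin 2) F) H (Multiplicative (ZMod r)))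
      (E₂ : GroupExtension (Multiplicative (F × F)) M H)
      (E₃ : GroupExtension M (mubAut (classicalMUB (F := F) p r ω)) (Multiplicative (ZMod 2))),
      -- the subgroup `F²` is normal in the whole group
      (E₂.inl.range.map E₃.inl).Normal ∧
      -- in odd characteristic the extensions split
      (p ≠ 2 → Nonempty E₁.Splitting ∧ Nonempty E₂.Splitting ∧ Nonempty E₃.Splitting ∧
        ∃ C : Subgroup (mubAut (classicalMUB (F := F) p r ω)),
          (E₂.inl.range.map E₃.inl).IsComplement' C) ∧
      -- in even characteristic `F².(SL₂(q).ℤ_r)` is non-split for `q ≥ 8`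
      (p = 2 → 8 ≤ Fintype.card F → IsEmpty E₂.Splitting)) ∧
    -- for `q = 2` the factor `ℤ₂` is absent in the group of the orthogonal decomposition
    (Fintype.card F = 2 →
      ∃ (H : Type u) (_ : Group H)
        (_ : GroupExtension (Matrix.SpecialLinearGroup (Fin 2) F) H (Multiplicative (ZMod r))),
        Nonempty (GroupExtension (Multiplicative (F × F))
          (odAut (classicalMUB (F := F) p r ω)) H)) := by
  have hchar : CharP F p := charP_of_injective_algebraMap' (ZMod p) p
  have h2 : (2 : F) = 0 ↔ p = 2 := by
    have h3 : ((2 : ℕ) : F) = 0 ↔ p ∣ 2 := CharP.cast_eq_zero_iff F p 2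
    rw [Nat.prime_dvd_prime_iff_eq Fact.out Nat.prime_two] at h3
    exact_mod_cast h3
  obtain ⟨χ, g, h⟩ := exists_isFramed_classicalMUB p r hq ω hω
  constructor
  · obtain ⟨e⟩ := nonempty_ringAut_mulEquiv hq
    obtain ⟨H, M, iH, iM, E₁, E₂, E₃, hnormal, hodd, heven⟩ := h.exists_extensions e
    exact ⟨H, M, iH, iM, E₁, E₂, E₃, hnormal, fun hp => hodd fun h0 => hp (h2.1 h0),
      fun hp => heven (h2.2 hp)⟩
  · intro hF
    -- Here 2 = p ^ r, so ℤ_r is trivial and SL₂(F) itself serves as the middle group H.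
    have hr : r = 1 := by
      rw [hF] at hq
      exact (Nat.prime_two.pow_eq_iff.1 hq.symm).2
    have : Subsingleton (Multiplicative (ZMod r)) := by
      subst hr
      exact inferInstanceAs (Subsingleton (Fin 1))
    exact ⟨_, inferInstance, GroupExtension.ofSubsingleton _ _, h.nonempty_odAut_extension hF⟩
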